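/- Consider the following first-price auction model with entry costs. There are $\overline{n}\ge 2$ potential buyers with i.i.d. signals $S_i$, uniform on $[0,1]$. Given the signals, the private values $V_i$ are independent with conditional c.d.f.s $F(\cdot|S_i)$, where, for some $0\le\underline v<\overline v$ and every $s\in[0,1]$, $F(\cdot|s)$ has support $[\underline v,\overline v]$ and a density $f(v|s)$ that is continuous and bounded away from $0$ on $[\underline v,\overline v]\times[0,1]$, and $s\mapsto F(v|s)$ is nonincreasing for every $v$. An observed auction characteristic $z$ takes values in a closed connected set $\mathcal Z\subset\mathbb R^d$ with non-empty interior; it affects only the entry cost $c(z)$, and $c(\cdot)$ is continuous and non-constant on $\mathcal Z$. Buyer $i$ enters, at cost $c(z)$, if and only if $S_i\ge s(z)$; let $$F_c(v|s)=\mathbb P(V_i\le v\mid S_i\ge s)=\frac1{1-s}\int_s^1F(v|t)\,dt .$$ The $N_c$ entrants observe $N_c$ and their private values (the analyst does not) and submit non-negative bids in a first-price auction. Given $N_c=n$ they play a symmetric Bayesian Nash equilibrium with values drawn independently from $F_c(\cdot|s(z))$, in strategies that are strictly increasing in the value when $n\ge2$ (a unique entrant bids $0$). The threshold satisfies $0<s(z)<1$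 for all $z\in\mathcal Z$ and the break-even condition: the expected profit from entering, gross of the cost, of a buyer with signal $s(z)$, when the other $\overline n-1$ buyers use the threshold $s(z)$, equals $c(z)$. Let $\mathbb G(\cdot|z)$ be the outcome distribution, that is the law of the outcome of the auction (``not sold'' if $N_c=0$, and otherwise the winning bid $W$), and let $G(b|z)=\mathbb G(W\le b\mid W>0,z)$. A quantity is identified from an observable if any two models of this kind with the same $\mathcal Z$ that give the same observable give the same value of the quantity. Then: (i) $\overline n$ and $F_c(\cdot|s(z))$ are identified from $G(\cdot|z)$, for every $z\in\mathcal Z$. (ii) If $\overline n\ge3$, then $\{s(z),z\in\mathcal Z\}$, $\{c(z),z\in\mathcal Z\}$ and $\{F(\cdot|s),s\in s(\mathcal Z)\}$ are identified from $\{G(\cdot|z),z\in\mathcal Z\}$. (iii) If $\overline n=2$, then $\{s(z),z\in\mathcal Z\}$, $\{c(z),z\in\mathcal Z\}$ and $\{F(\cdot|s),s\in s(\mathcal Z)\}$ are identified from the outcome distributions $\{\mathbb G(\cdot|z),z\in\mathcal Z\}$. -/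

import Mathlib

open MeasureTheory ProbabilityTheory Set

/-- The data of an affiliated-signal entry auction whose entry cost depends on an observed
auction characteristic `z : E`. -/
structure EntryModel (E : Type*) where
  /-- number of potential entrants -/
  nbar : ℕ
  /-- lower end of the support of private values -/
  vlo : ℝ
  /-- upper end of the support of private values -/
  vhi : ℝ
  /-- `valueLaw s` is the law of a private value given the first-stage signal `s`; only signals in
  `[0, 1]` matter -/
  valueLaw : Kernel ℝ ℝ
  /-- the entry cost as a function of the auction characteristic -/
  cost : E → ℝ

/-- Strategies: the entry threshold on signals, and the bid of an entrant as a function of the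
auction characteristic, the observed number of entrants and her private value. -/
structure StrategyProfile (E : Type*) where
  threshold : E → ℝ
  bid : E → ℕ → ℝ → ℝ

/-- The probability that the bid `x` beats `m` independent rivals, whose values have law `μ` and who
bid according to `β`. (Ties have probability zero when `β` is strictly increasing and `μ` has no
atoms; with `m = 0` every bid wins.) -/
noncomputable def winProb (μ : Measure ℝ) (β : ℝ → ℝ) (m : ℕ) (x : ℝ) : ℝ :=
  μ.real {w | β w ≤ x} ^ m

/-- `β` is a symmetric Bayesian Nash equilibrium of the first-price auction in which it is commonly
known that there are `n` bidders, their private values are independent with law `μ` supported by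
`[lo, hi]`, and bids are nonnegative. With at least two bidders the strategy is increasing in the
private value. -/
structure IsBiddingEquilibrium (μ : Measure ℝ) (lo hi : ℝ) (n : ℕ) (β : ℝ → ℝ) : Prop where
  measurable : Measurable β
  nonneg : ∀ v ∈ Icc lo hi, 0 ≤ β v
  strictMono : 2 ≤ n → StrictMonoOn β (Icc lo hi)
  bestResponse : ∀ v ∈ Icc lo hi, ∀ x, 0 ≤ x →
    (v - x) * winProb μ β (n - 1) x ≤ (v - β v) * winProb μ β (n - 1) (β v)

namespace EntryModel

variable {E : Type*}

/-- The conditional c.d.f. `F(v | s)` of a private value given the signal `s`. -/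
noncomputable def F (M : EntryModel E) (v s : ℝ) : ℝ := cdf (M.valueLaw s) v

/-- The joint law of (signal, private value) of one potential entrant; signals are uniform. -/
noncomputable def jointLaw (M : EntryModel E) : Measure (ℝ × ℝ) :=
  (volume.restrict (Icc (0 : ℝ) 1)) ⊗ₘ M.valueLaw

/-- The law of the private value of a buyer given that her signal is at least `s`. -/
noncomputable def entrantLaw (M : EntryModel E) (s : ℝ) : Measure ℝ :=
  (cond M.jointLaw {p | s ≤ p.1}).map Prod.snd

/-- The updated c.d.f. `F_c(v | s) = P(V ≤ v | S ≥ s)`. -/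
noncomputable def Fc (M : EntryModel E) (v s : ℝ) : ℝ := cdf (M.entrantLaw s) v

/-- The standing assumptions on the primitives. The density condition gives that `[vlo, vhi]` is
the support of `F(· | s)` and that `F` is continuous on `[vlo, vhi] × [0, 1]`. -/
structure AssumptionE [TopologicalSpace E] (M : EntryModel E) (Z : Set E) : Prop where
  two_le : 2 ≤ M.nbar
  vlo_nonneg : 0 ≤ M.vlo
  vlo_lt_vhi : M.vlo < M.vhi
  markov : IsMarkovKernel M.valueLaw
  density : ∃ f : ℝ → ℝ → ℝ,
    ContinuousOn (Function.uncurry f) (Icc M.vlo M.vhi ×ˢ Icc (0 : ℝ) 1) ∧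
    (∃ ε > 0, ∀ v ∈ Icc M.vlo M.vhi, ∀ s ∈ Icc (0 : ℝ) 1, ε ≤ f v s) ∧
    ∀ s ∈ Icc (0 : ℝ) 1, M.valueLaw s =
      (volume.restrict (Icc M.vlo M.vhi)).withDensity (fun v => ENNReal.ofReal (f v s))
  antitone : ∀ v ∈ Icc M.vlo M.vhi, AntitoneOn (fun s => M.F v s) (Icc (0 : ℝ) 1)
  cost_continuous : ContinuousOn M.cost Z
  cost_nonconstant : ∃ z ∈ Z, ∃ z' ∈ Z, M.cost z ≠ M.cost z'
  closed : IsClosed Z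
  connected : IsConnected Z
  interior_nonempty : (interior Z).Nonempty

/-- The first-stage expected profit, gross of the entry cost, of a buyer with signal `S` who enters
an auction where each of the `nbar - 1` other buyers enters when her signal is at least `s` and the
`n` entrants bid according to `β n`: the number `m` of rivals is binomial `(nbar - 1, 1 - s)`, and
the values of the rivals have law `entrantLaw s`. -/
noncomputable def entryProfit (M : EntryModel E) (β : ℕ → ℝ → ℝ) (S s : ℝ) : ℝ :=
  ∑ m ∈ Finset.range M.nbar, ((M.nbar - 1).choose m : ℝ) * (1 - s) ^ m * s ^ (M.nbar - 1 - m) *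
    ∫ v, (v - β (m + 1) v) * winProb (M.entrantLaw s) (β (m + 1)) m (β (m + 1) v) ∂(M.valueLaw S)

/-- The profile `σ` is an equilibrium with thresholds strictly between `0` and `1`: the threshold
signal breaks even, and the `n` entrants, who observe `n`, play a symmetric equilibrium of the
first-price auction with the updated value distribution. -/
structure IsInteriorEquilibrium (M : EntryModel E) (Z : Set E) (σ : StrategyProfile E) : Prop where
  threshold_mem : ∀ z ∈ Z, σ.threshold z ∈ Ioo (0 : ℝ) 1
  bidding : ∀ z ∈ Z, ∀ n, 1 ≤ n → n ≤ M.nbar →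
    IsBiddingEquilibrium (M.entrantLaw (σ.threshold z)) M.vlo M.vhi n (σ.bid z n)
  breakEven : ∀ z ∈ Z, M.entryProfit (σ.bid z) (σ.threshold z) (σ.threshold z) = M.cost z

/-- The buyers who enter when `ω i` is the (signal, private value) pair of buyer `i`. -/
noncomputable def entrants {n : ℕ} (s : ℝ) (ω : Fin n → ℝ × ℝ) : Finset (Fin n) :=
  Finset.univ.filter (fun i => s ≤ (ω i).1)

/-- The outcome of an auction: `Sum.inl ()` when the object is not sold (no entrant), and `Sum.inr w`
when it is sold at the winning bid `w`, the highest bid of the entrants. -/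
noncomputable def outcome {n : ℕ} (s : ℝ) (β : ℕ → ℝ → ℝ) (ω : Fin n → ℝ × ℝ) : Unit ⊕ ℝ :=
  if h : (entrants s ω).Nonempty then
    Sum.inr ((entrants s ω).sup' h (fun i => β (entrants s ω).card (ω i).2))
  else Sum.inl ()

/-- The outcome distribution given the auction characteristic `z`: the pairs (signal, value) of the
`nbar` potential entrants are i.i.d. -/
noncomputable def outcomeLaw (M : EntryModel E) (σ : StrategyProfile E) (z : E) :
    Measure (Unit ⊕ ℝ) :=
  (Measure.pi (fun _ : Fin M.nbar => M.jointLaw)).map (outcome (σ.threshold z) (σ.bid z))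

/-- The winning bid c.d.f. `G(b | z)`, the conditional probability of `W ≤ b` given `W > 0`. -/
noncomputable def winningBidCDF (M : EntryModel E) (σ : StrategyProfile E) (z : E) (b : ℝ) : ℝ :=
  (cond (M.outcomeLaw σ z) (Sum.inr '' Ioi 0)).real (Sum.inr '' Iic b)

end EntryModel

/-! A lone entrant bids zero, while with two or more entrants every bid is almost surely positive.
So conditioning on `W > 0` leaves a mixture, over `k + 2` entrants, of the c.d.f.s of the highest of
`k + 2` equilibrium bids. By the envelope theorem these bids depend only on the quantile function
`Q` of the entrants' values (`bid_quantile`, `winningBidCDF_eq_mixtureCDF`).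

The mixture is inverted in `mixtureCDF_identification`. The top bid strictly increases with the
number of bidders, and the density of the highest bid drops there. The kinks of the mixture thus
reveal the number of components and their top bids. The size of each drop gives a weight up to the
unknown factor `Q 1 - Q.bid k 1`, and the fact that the weights sum to one then yields `Q 1` and all
the weights. Finally `Q` is recovered downwards from `1`: once it is known on `[a, 1]`, all
components but the one with most bidders are known somewhat below that component's bid at `a`.
Subtracting them and using the first-order condition extends `Q` below `a`.

With three or more buyers, the relative weights of two and three entrants give the threshold; with
two buyers, the probability of no sale does. The break-even profit is strictly increasing in the
threshold, so connectedness of the set of characteristics makes the thresholds a nondegenerate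
interval. There `F(v | s)` is minus the derivative of `(1 - s) * Fc v s`, and the cost is the
break-even profit. -/

/-! ### Envelope theorem. -/

/-- Using the inequality in both directions puts `U x - U c - q c * (φ x - φ c)` between `0` and `(q
x - q c) * (φ x - φ c)`, which is `o(1) * O(x - c)`. No regularity of `U` is needed, hence none of
the bidding strategies. -/
lemma hasDerivWithinAt_of_increment_le {U q φ : ℝ → ℝ} {s : Set ℝ} {c φ' : ℝ}
    (h : ∀ x ∈ s, ∀ y ∈ s, U x - U y ≤ q x * (φ x - φ y)) (hc : c ∈ s)
    (hq : ContinuousWithinAt q s c) (hφ : HasDerivWithinAt φ φ' s c) :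
    HasDerivWithinAt U (q c * φ') s c := by
  have h0 : HasDerivWithinAt (fun x => U x - q c * φ x) 0 s c := by
    rw [hasDerivWithinAt_iff_isLittleO]
    have h1 : (fun x => q x - q c) =o[nhdsWithin c s] (fun _ => (1 : ℝ)) := by
      rw [Asymptotics.isLittleO_one_iff]
      simpa using Filter.Tendsto.sub_const hq (q c)
    have h2 : (fun x => φ x - φ c) =O[nhdsWithin c s] (fun x => x - c) :=
      hφ.hasFDerivWithinAt.isBigO_sub
    have h3 := h1.mul_isBigO h2
    simp only [one_mul] at h3
    refine Asymptotics.IsBigO.trans_isLittleO ?_ h3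
    refine Asymptotics.IsBigO.of_bound 1 ?_
    filter_upwards [self_mem_nhdsWithin] with x hx
    have e1 := h x hx c hc
    have e2 := h c hc x hx
    simp only [smul_zero, sub_zero, one_mul, Real.norm_eq_abs]
    refine abs_le_abs_of_nonneg ?_ ?_ <;> nlinarith
  have h4 := h0.add (hφ.const_mul (q c))
  refine (h4.congr_deriv (by ring)).congr_of_eventuallyEq ?_ ?_
  · exact Filter.Eventually.of_forall fun x => by simp
  · simp

/-- The envelope theorem: `U` is the integral of its marginal increments. -/
lemma integral_of_increment_le {U q φ φ' : ℝ → ℝ} {a b : ℝ} (hab : a ≤ b)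
    (h : ∀ x ∈ Icc a b, ∀ y ∈ Icc a b, U x - U y ≤ q x * (φ x - φ y))
    (hq : ContinuousOn q (Icc a b)) (hφ : ∀ x, HasDerivAt φ (φ' x) x)
    (hφ' : Continuous φ') : ∫ x in a..b, q x * φ' x = U b - U a := by
  have hd : ∀ x ∈ Icc a b, HasDerivWithinAt U (q x * φ' x) (Icc a b) x := fun x hx =>
    hasDerivWithinAt_of_increment_le h hx (hq x hx) (hφ x).hasDerivWithinAt
  refine intervalIntegral.integral_eq_sub_of_hasDerivAt_of_le hab
    (fun x hx => (hd x hx).continuousWithinAt)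
    (fun x hx => (hd x (Ioo_subset_Icc_self hx)).hasDerivAt (Icc_mem_nhds hx.1 hx.2)) ?_
  refine ContinuousOn.intervalIntegrable ?_
  rw [uIcc_of_le hab]
  exact hq.mul hφ'.continuousOn

/-! ### Equilibrium bids as functions of the value quantile. -/

/-- The mean of `Q (a * u)`, where `u` is the maximum of `k + 1` independent uniform variables. When
`Q` is the quantile function of the private values, this is the equilibrium bid at the value
quantile `a` in the first-price auction with `k + 2` bidders. -/
noncomputable def bidQuantile (Q : ℝ → ℝ) (k : ℕ) (a : ℝ) : ℝ :=
  ∫ u in (0 : ℝ)..1, Q (a * u) * ((k + 1) * u ^ k)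

section
variable {Q : ℝ → ℝ} {k : ℕ}

lemma integral_weight (k : ℕ) : ∫ u in (0 : ℝ)..1, ((k + 1) * u ^ k : ℝ) = 1 := by
  rw [intervalIntegral.integral_const_mul, integral_pow]
  field_simp
  simp

lemma bidQuantile_zero : bidQuantile Q k 0 = Q 0 := by
  simp only [bidQuantile, zero_mul]
  rw [intervalIntegral.integral_const_mul, integral_weight, mul_one]

lemma continuous_bidQuantile (hQ : Continuous Q) : Continuous (bidQuantile Q k) := by
  unfold bidQuantile
  apply intervalIntegral.continuous_parametric_intervalIntegral_of_continuous'
    (f := fun a u => Q (a * u) * ((k + 1) * u ^ k))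
  simp only [Function.uncurry_def]
  fun_prop

lemma strictMono_bidQuantile (hQ : Continuous Q) (hm : StrictMono Q) :
    StrictMono (bidQuantile Q k) := by
  intro a b hab
  unfold bidQuantile
  refine intervalIntegral.integral_lt_integral_of_continuousOn_of_le_of_exists_lt zero_lt_one
    (by fun_prop) (by fun_prop) ?_ ⟨1, by simp, ?_⟩
  · intro u hu
    have : Q (a * u) ≤ Q (b * u) := hm.monotone (by nlinarith [hu.1])
    have h2 : (0 : ℝ) ≤ (k + 1) * u ^ k := by have := hu.1; positivity
    exact mul_le_mul_of_nonneg_right this h2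
  · have := hm hab
    simp only [mul_one, one_pow]
    have hk : (0 : ℝ) < k + 1 := by positivity
    nlinarith

lemma integral_weight_mul_id (k : ℕ) (a c : ℝ) :
    ∫ u in (0 : ℝ)..1, ((a * u + c) * ((k + 1) * u ^ k) : ℝ) = a * ((k + 1) / (k + 2)) + c := by
  have : ∀ u : ℝ, ((a * u + c) * ((k + 1) * u ^ k) : ℝ) =
    a * (k + 1) * u ^ (k + 1) + c * ((k + 1) * u ^ k) := fun u => by ring
  simp only [this]
  rw [intervalIntegral.integral_add, intervalIntegral.integral_const_mul,
    intervalIntegral.integral_const_mul, integral_weight, integral_pow]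
  · have h2 : ((k : ℝ) + 2) ≠ 0 := by positivity
    have h3 : ((k : ℝ) + 1 + 1) ≠ 0 := by positivity
    push_cast
    field_simp
    simp
    ring
  · exact Continuous.intervalIntegrable (by fun_prop) _ _
  · exact Continuous.intervalIntegrable (by fun_prop) _ _

/-- The slope `(k + 1) / (k + 2)` is the mean of the maximum of `k + 1` uniform variables. Staying
near a line of positive slope gives surjectivity, hence a globally defined inverse bid. -/
lemma abs_bidQuantile_sub_le (hQ : Continuous Q) {C : ℝ} (hC : ∀ x, |Q x - x| ≤ C) (a : ℝ) :
    |bidQuantile Q k a - a * ((k + 1) / (k + 2))| ≤ C := by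
  have hle : ∀ x, Q x ≤ x + C := fun x => by linarith [(abs_le.1 (hC x)).2]
  have hge : ∀ x, x + -C ≤ Q x := fun x => by linarith [(abs_le.1 (hC x)).1]
  have hw : ∀ u ∈ Icc (0 : ℝ) 1, (0 : ℝ) ≤ (k + 1) * u ^ k := fun u hu => by
    have := hu.1
    positivity
  have h1 : bidQuantile Q k a ≤ a * ((k + 1) / (k + 2)) + C := by
    rw [← integral_weight_mul_id k a C]
    refine intervalIntegral.integral_mono_on zero_le_one
      (Continuous.intervalIntegrable (by fun_prop) _ _)
      (Continuous.intervalIntegrable (by fun_prop) _ _) fun u hu => ?_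
    exact mul_le_mul_of_nonneg_right (hle _) (hw u hu)
  have h2 : a * ((k + 1) / (k + 2)) + -C ≤ bidQuantile Q k a := by
    rw [← integral_weight_mul_id k a (-C)]
    refine intervalIntegral.integral_mono_on zero_le_one
      (Continuous.intervalIntegrable (by fun_prop) _ _)
      (Continuous.intervalIntegrable (by fun_prop) _ _) fun u hu => ?_
    exact mul_le_mul_of_nonneg_right (hge _) (hw u hu)
  rw [abs_le]
  constructor <;> linarith

lemma surjective_bidQuantile (hQ : Continuous Q) {C : ℝ} (hC : ∀ x, |Q x - x| ≤ C) :
    Function.Surjective (bidQuantile Q k) := by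
  have hr : (0 : ℝ) < (k + 1) / (k + 2) := by positivity
  have hlin : ∀ x, |bidQuantile Q k x - x * ((k + 1) / (k + 2))| ≤ C :=
    abs_bidQuantile_sub_le hQ hC
  refine (continuous_bidQuantile hQ).surjective ?_ ?_
  · refine Filter.tendsto_atTop_mono (f := fun x => x * ((k + 1) / (k + 2)) + -C)
      (fun x => by linarith [(abs_le.1 (hlin x)).1]) ?_
    exact Filter.tendsto_atTop_add_const_right _ _ (Filter.tendsto_id.atTop_mul_const hr)
  · refine Filter.tendsto_atBot_mono (f := fun x => x * ((k + 1) / (k + 2)) + C)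
      (fun x => by linarith [(abs_le.1 (hlin x)).2]) ?_
    exact Filter.tendsto_atBot_add_const_right _ _ (Filter.tendsto_id.atBot_mul_const hr)

lemma pow_mul_bidQuantile (a : ℝ) :
    a ^ (k + 1) * bidQuantile Q k a = ∫ t in (0 : ℝ)..a, Q t * ((k + 1) * t ^ k) := by
  have := intervalIntegral.smul_integral_comp_mul_left (a := 0) (b := 1)
    (fun t => Q t * ((k + 1) * t ^ k)) a
  rw [mul_zero, mul_one] at this
  rw [← this, bidQuantile, smul_eq_mul, ← intervalIntegral.integral_const_mul,
    ← intervalIntegral.integral_const_mul]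
  congr 1
  ext u
  ring

lemma bidQuantile_eq_div {a : ℝ} (ha : a ≠ 0) :
    bidQuantile Q k a = (∫ t in (0 : ℝ)..a, Q t * ((k + 1) * t ^ k)) / a ^ (k + 1) := by
  rw [← pow_mul_bidQuantile]
  field_simp

/-- The bidder's first-order condition. Read backwards, it recovers `Q a` from the bid and its
derivative. -/
lemma hasDerivAt_bidQuantile (hQ : Continuous Q) {a : ℝ} (ha : 0 < a) :
    HasDerivAt (bidQuantile Q k) ((k + 1) * (Q a - bidQuantile Q k a) / a) a := by
  have h1 : HasDerivAt (fun a => ∫ t in (0 : ℝ)..a, Q t * ((k + 1) * t ^ k))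
      (Q a * ((k + 1) * a ^ k)) a :=
    intervalIntegral.integral_hasDerivAt_right (Continuous.intervalIntegrable (by fun_prop) _ _)
      (Continuous.stronglyMeasurableAtFilter (by fun_prop) _ _)
      (Continuous.continuousAt (by fun_prop))
  have h2 := h1.div (hasDerivAt_pow (k + 1) a) (pow_ne_zero _ ha.ne')
  refine (h2.congr_of_eventuallyEq ?_).congr_deriv ?_
  · filter_upwards [lt_mem_nhds ha] with x hx
    exact bidQuantile_eq_div hx.ne'
  · rw [bidQuantile_eq_div ha.ne']
    push_cast
    field_simp
    ring

lemma bidQuantile_lt (hQ : Continuous Q) (hm : StrictMono Q) {a : ℝ} (ha : 0 < a) :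
    bidQuantile Q k a < Q a := by
  have : Q a = ∫ u in (0 : ℝ)..1, Q a * ((k + 1) * u ^ k) := by
    rw [intervalIntegral.integral_const_mul, integral_weight, mul_one]
  rw [this, bidQuantile]
  -- The integrands agree at `u = 1` and, when `k > 0`, at `u = 0`, so strictness is witnessed at an
  -- interior point.
  refine intervalIntegral.integral_lt_integral_of_continuousOn_of_le_of_exists_lt zero_lt_one
    (by fun_prop) (by fun_prop) ?_ ⟨1 / 2, by norm_num, ?_⟩
  · intro u hu
    refine mul_le_mul_of_nonneg_right (hm.monotone (by nlinarith [hu.2])) ?_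
    have := hu.1
    positivity
  · exact mul_lt_mul_of_pos_right (hm (by linarith)) (by positivity)

/-- The difference of the two bids, multiplied by `x ^ (k + 2)`, vanishes at `0`; by the two
first-order conditions its derivative is `x ^ (k + 1) * (Q x - bidQuantile Q k x)`, positive by bid
shading. -/
lemma bidQuantile_lt_succ (hQ : Continuous Q) (hm : StrictMono Q) {a : ℝ} (ha : 0 < a) :
    bidQuantile Q k a < bidQuantile Q (k + 1) a := by
  have hd : ∀ x, 0 < x → HasDerivAt
      (fun x => x ^ (k + 2) * (bidQuantile Q (k + 1) x - bidQuantile Q k x))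
      (x ^ (k + 1) * (Q x - bidQuantile Q k x)) x := by
    intro x hx
    have h := ((hasDerivAt_pow (k + 2) x).mul
      ((hasDerivAt_bidQuantile (k := k + 1) hQ hx).sub (hasDerivAt_bidQuantile (k := k) hQ hx)))
    refine h.congr_deriv ?_
    simp only [Pi.sub_apply]
    push_cast
    field_simp
    ring
  have hs : StrictMonoOn
      (fun x => x ^ (k + 2) * (bidQuantile Q (k + 1) x - bidQuantile Q k x)) (Ici 0) := by
    refine strictMonoOn_of_deriv_pos (convex_Ici 0) ?_ ?_
    · have h1 := continuous_bidQuantile (k := k + 1) hQ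
      have h2 := continuous_bidQuantile (k := k) hQ
      fun_prop
    · intro x hx
      rw [interior_Ici] at hx
      rw [(hd x hx).deriv]
      exact mul_pos (pow_pos hx _) (sub_pos.2 (bidQuantile_lt hQ hm hx))
  have := hs (self_mem_Ici) ha.le ha
  simp only [ne_eq, Nat.add_eq_zero_iff, OfNat.ofNat_ne_zero, and_false, not_false_eq_true,
    zero_pow, zero_mul] at this
  have h2 := (mul_pos_iff_of_pos_left (pow_pos ha (k + 2))).1 this
  linarith

lemma strictMono_bidQuantile_index (hQ : Continuous Q) (hm : StrictMono Q) {a : ℝ} (ha : 0 < a) :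
    StrictMono (fun k => bidQuantile Q k a) :=
  strictMono_nat_of_lt_succ fun _ => bidQuantile_lt_succ hQ hm ha

end

/-! ### Kinks of the distribution of the highest bid. -/

/-- Truncation of a real number to `[0, 1]`. -/
noncomputable def unitClamp (x : ℝ) : ℝ := max 0 (min x 1)

lemma unitClamp_of_nonpos {x : ℝ} (h : x ≤ 0) : unitClamp x = 0 :=
  max_eq_left (min_le_of_left_le h)

lemma unitClamp_of_one_le {x : ℝ} (h : 1 ≤ x) : unitClamp x = 1 := by
  simp [unitClamp, h]

lemma unitClamp_of_mem {x : ℝ} (h0 : 0 ≤ x) (h1 : x ≤ 1) : unitClamp x = x := by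
  simp [unitClamp, h0, h1]

lemma unitClamp_nonneg (x : ℝ) : 0 ≤ unitClamp x := le_max_left _ _

lemma eq_of_unitClamp_eq {x y : ℝ} (h0 : 0 < x) (h1 : x < 1) (h : unitClamp y = x) : y = x := by
  rcases le_total y 0 with hy | hy
  · rw [unitClamp_of_nonpos hy] at h
    exact absurd h h0.ne
  rcases le_total 1 y with hy' | hy'
  · rw [unitClamp_of_one_le hy'] at h
    exact absurd h h1.ne'
  · rwa [unitClamp_of_mem hy hy'] at h

/-- A quantile function on `[0, 1]`, extended to an order isomorphism of the real line that stays
at bounded distance from the identity. -/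
structure QuantileIso where
  toOrderIso : ℝ ≃o ℝ
  bounded : ∃ C, ∀ x, |toOrderIso x - x| ≤ C

namespace QuantileIso

instance : CoeFun QuantileIso (fun _ => ℝ → ℝ) := ⟨fun Q => Q.toOrderIso⟩

variable (Q : QuantileIso) {k : ℕ}

lemma continuous : Continuous Q := Q.toOrderIso.continuous

lemma strictMono : StrictMono Q := Q.toOrderIso.strictMono

/-- The equilibrium bid with `k + 2` bidders as a function of the quantile of the value. -/
noncomputable def bid (k : ℕ) : ℝ ≃o ℝ :=
  (strictMono_bidQuantile (k := k) Q.continuous Q.strictMono).orderIsoOfSurjective _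
    (surjective_bidQuantile Q.continuous Q.bounded.choose_spec)

lemma bid_apply (k : ℕ) (a : ℝ) : Q.bid k a = bidQuantile Q k a := rfl

lemma bid_zero : Q.bid k 0 = Q 0 := bidQuantile_zero

lemma bid_lt {a : ℝ} (ha : 0 < a) : Q.bid k a < Q a :=
  bidQuantile_lt Q.continuous Q.strictMono ha

lemma strictMono_bid_index {a : ℝ} (ha : 0 < a) : StrictMono (fun k => Q.bid k a) :=
  strictMono_bidQuantile_index Q.continuous Q.strictMono ha

lemma hasDerivAt_bid {a : ℝ} (ha : 0 < a) :
    HasDerivAt (Q.bid k) ((k + 1) * (Q a - Q.bid k a) / a) a :=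
  hasDerivAt_bidQuantile Q.continuous ha

lemma bid_deriv_pos {a : ℝ} (ha : 0 < a) : 0 < (k + 1) * (Q a - Q.bid k a) / a := by
  have := sub_pos.2 (Q.bid_lt (k := k) ha)
  positivity

lemma symm_bid_pos {b : ℝ} (hb : Q 0 < b) : 0 < (Q.bid k).symm b := by
  rw [OrderIso.lt_symm_apply, bid_zero]
  exact hb

/-- The value of the derivative matters only at the top bid, where it determines the size of the
kink. -/
lemma hasDerivAt_symm_bid {b : ℝ} (hb : Q 0 < b) :
    ∃ D, HasDerivAt (Q.bid k).symm D b ∧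
      (b = Q.bid k 1 → D = ((k + 1) * (Q 1 - Q.bid k 1))⁻¹) := by
  have ha := Q.symm_bid_pos (k := k) hb
  refine ⟨_, HasDerivAt.of_local_left_inverse (Q.bid k).symm.continuous.continuousAt
    (Q.hasDerivAt_bid ha) (Q.bid_deriv_pos ha).ne' (.of_forall (Q.bid k).apply_symm_apply), ?_⟩
  rintro rfl
  simp

/-- The c.d.f. of the highest of `k + 2` equilibrium bids. -/
noncomputable def maxBidCDF (k : ℕ) (b : ℝ) : ℝ := unitClamp ((Q.bid k).symm b) ^ (k + 2)

/-- The jump, at the highest possible bid, of the density of the highest of `k + 2` bids. -/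
noncomputable def densityJump (k : ℕ) : ℝ := (k + 2) / ((k + 1) * (Q 1 - Q.bid k 1))

lemma densityJump_pos : 0 < Q.densityJump k := by
  have := sub_pos.2 (Q.bid_lt (k := k) one_pos)
  unfold densityJump
  positivity

/-- The c.d.f. is differentiable except at the top bid, where it reaches its maximum `1` with a
positive left slope. Writing the left derivative as the right one plus a jump lets jumps be added
over a mixture while `r` stays unspecified. -/
lemma maxBidCDF_one_sided_deriv {b : ℝ} (hb : Q 0 < b) :
    ∃ r, HasDerivWithinAt (Q.maxBidCDF k)
        (r + if b = Q.bid k 1 then Q.densityJump k else 0) (Iic b) b ∧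
      HasDerivWithinAt (Q.maxBidCDF k) r (Ici b) b := by
  have ha := Q.symm_bid_pos (k := k) hb
  obtain ⟨D, hD, hD1⟩ := Q.hasDerivAt_symm_bid (k := k) hb
  have hc : ContinuousAt (Q.bid k).symm b := hD.continuousAt
  have hpow := hD.pow (k + 2)
  rcases lt_trichotomy ((Q.bid k).symm b) 1 with h | h | h
  · have hne : b ≠ Q.bid k 1 := by
      rintro rfl
      simp at h
    have : HasDerivAt (Q.maxBidCDF k) _ b := hpow.congr_of_eventuallyEq (by
      filter_upwards [hc.eventually (lt_mem_nhds ha), hc.eventually (gt_mem_nhds h)] with x h1 h2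
      simp [maxBidCDF, unitClamp_of_mem h1.le h2.le])
    simp only [if_neg hne, add_zero]
    exact ⟨_, this.hasDerivWithinAt, this.hasDerivWithinAt⟩
  · have hbe : b = Q.bid k 1 := by rw [← h]; simp
    refine ⟨0, ?_, ?_⟩
    · rw [if_pos hbe, zero_add]
      refine (hpow.hasDerivWithinAt (s := Iic b)).congr_of_eventuallyEq ?_ ?_ |>.congr_deriv ?_
      · filter_upwards [self_mem_nhdsWithin,
          (hc.eventually (lt_mem_nhds ha)).filter_mono nhdsWithin_le_nhds] with x hx h1
        have h2 : (Q.bid k).symm x ≤ 1 := h ▸ (Q.bid k).symm.monotone hx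
        simp [maxBidCDF, unitClamp_of_mem h1.le h2]
      · simp [maxBidCDF, h, unitClamp_of_one_le]
      · rw [h, hD1 hbe, densityJump]
        push_cast
        field_simp
        simp
    · refine (hasDerivWithinAt_const b (Ici b) (1 : ℝ)).congr (fun x hx => ?_) ?_
      · have h2 : 1 ≤ (Q.bid k).symm x := h ▸ (Q.bid k).symm.monotone hx
        simp [maxBidCDF, unitClamp_of_one_le h2]
      · simp [maxBidCDF, h, unitClamp_of_one_le]
  · have hne : b ≠ Q.bid k 1 := by
      rintro rfl
      simp at h
    have : HasDerivAt (Q.maxBidCDF k) 0 b := (hasDerivAt_const b (1 : ℝ)).congr_of_eventuallyEq (by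
      filter_upwards [hc.eventually (lt_mem_nhds h)] with x h1
      simp [maxBidCDF, unitClamp_of_one_le h1.le])
    simp only [if_neg hne, add_zero]
    exact ⟨_, this.hasDerivWithinAt, this.hasDerivWithinAt⟩

/-- The mixture, with weights `p k`, of the c.d.f.s of the highest of `k + 2` equilibrium bids. -/
noncomputable def mixtureCDF (K : ℕ) (p : ℕ → ℝ) (b : ℝ) : ℝ :=
  ∑ k ∈ Finset.range (K + 1), p k * Q.maxBidCDF k b

/-- The downward jump at `b` of the density of the mixture. -/
noncomputable def mixtureJump (K : ℕ) (p : ℕ → ℝ) (b : ℝ) : ℝ :=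
  ∑ k ∈ Finset.range (K + 1), p k * if b = Q.bid k 1 then Q.densityJump k else 0

lemma mixtureCDF_one_sided_deriv (K : ℕ) (p : ℕ → ℝ) {b : ℝ} (hb : Q 0 < b) :
    ∃ r, HasDerivWithinAt (Q.mixtureCDF K p) (r + Q.mixtureJump K p b) (Iic b) b ∧
      HasDerivWithinAt (Q.mixtureCDF K p) r (Ici b) b := by
  choose r h1 h2 using fun k => Q.maxBidCDF_one_sided_deriv (k := k) hb
  refine ⟨∑ k ∈ Finset.range (K + 1), p k * r k, ?_, ?_⟩
  · refine (HasDerivWithinAt.fun_sum fun k _ => (h1 k).const_mul (p k)).congr_deriv ?_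
    simp [mixtureJump, mul_add, Finset.sum_add_distrib]
  · exact HasDerivWithinAt.fun_sum fun k _ => (h2 k).const_mul (p k)

/-- Top bids with different numbers of bidders are distinct, so each kink belongs to one component.
-/
lemma mixtureJump_bid {K : ℕ} (p : ℕ → ℝ) (hk : k ≤ K) :
    Q.mixtureJump K p (Q.bid k 1) = p k * Q.densityJump k := by
  rw [mixtureJump, Finset.sum_eq_single k]
  · simp
  · intro j _ hj
    have : Q.bid k 1 ≠ Q.bid j 1 := fun h =>
      hj ((Q.strictMono_bid_index one_pos).injective h).symm
    simp [this]
  · intro h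
    simp at h
    omega

lemma mixtureJump_ne_zero_iff {K : ℕ} {p : ℕ → ℝ} (hp : ∀ k ≤ K, 0 < p k) {b : ℝ} :
    Q.mixtureJump K p b ≠ 0 ↔ ∃ k ≤ K, b = Q.bid k 1 := by
  constructor
  · intro h
    by_contra! hn
    refine h (Finset.sum_eq_zero fun k hk => ?_)
    rw [if_neg (hn k (by simp at hk; omega)), mul_zero]
  · rintro ⟨k, hk, rfl⟩
    rw [Q.mixtureJump_bid p hk]
    exact (mul_pos (hp k hk) Q.densityJump_pos).ne'

lemma maxBidCDF_eq_zero {b : ℝ} (hb : b ≤ Q 0) : Q.maxBidCDF k b = 0 := by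
  have : (Q.bid k).symm b ≤ 0 := by rwa [OrderIso.symm_apply_le, bid_zero]
  simp [maxBidCDF, unitClamp_of_nonpos this]

lemma maxBidCDF_pos {b : ℝ} (hb : Q 0 < b) : 0 < Q.maxBidCDF k b := by
  refine pow_pos (lt_max_of_lt_right (lt_min ?_ one_pos)) _
  exact Q.symm_bid_pos hb

lemma mixtureCDF_pos_iff {K : ℕ} {p : ℕ → ℝ} (hp : ∀ k ≤ K, 0 < p k) {b : ℝ} :
    0 < Q.mixtureCDF K p b ↔ Q 0 < b := by
  constructor
  · intro h
    by_contra! hb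
    refine h.ne' (Finset.sum_eq_zero fun k _ => ?_)
    rw [Q.maxBidCDF_eq_zero hb, mul_zero]
  · intro hb
    refine Finset.sum_pos (fun k hk => mul_pos (hp k (by simp at hk; omega)) (Q.maxBidCDF_pos hb))
      ⟨0, by simp⟩

end QuantileIso

/-! ### Identification of a mixture of highest-bid distributions. -/

/-- Once the smaller elements are matched, the next one is the least remaining element of the common
set, whichever enumeration is used. -/
lemma eq_of_strictMono_of_image_eq {f g : ℕ → ℝ} (hf : StrictMono f) (hg : StrictMono g) {K L : ℕ}
    (h : ∀ b, (∃ k ≤ K, b = f k) ↔ ∃ k ≤ L, b = g k) : K = L ∧ ∀ k ≤ K, f k = g k := by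
  have hmain : ∀ k, k ≤ K → k ≤ L → (∀ j < k, f j = g j) → f k = g k := by
    intro k hkK hkL ih
    obtain ⟨i, hi, hfi⟩ := (h (f k)).1 ⟨k, hkK, rfl⟩
    obtain ⟨j, hj, hgj⟩ := (h (g k)).2 ⟨k, hkL, rfl⟩
    have hik : k ≤ i := by
      by_contra! hlt
      have := ih i hlt
      rw [← hfi] at this
      exact hlt.ne (hf.injective this)
    have hjk : k ≤ j := by
      by_contra! hlt
      have := ih j hlt
      rw [← hgj] at this
      exact hlt.ne' (hg.injective this)
    have h1 : g k ≤ f k := hfi ▸ hg.monotone hik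
    have h2 : f k ≤ g k := hgj ▸ hf.monotone hjk
    exact le_antisymm h2 h1
  have hall : ∀ k, k ≤ K → k ≤ L → f k = g k := by
    intro k
    induction k using Nat.strong_induction_on with
    | _ k ih => exact fun h1 h2 => hmain k h1 h2 fun j hj => ih j hj (by omega) (by omega)
  have hKL : K = L := by
    rcases lt_trichotomy K L with hlt | heq | hlt
    · obtain ⟨i, hi, hgi⟩ := (h (g L)).2 ⟨L, le_rfl, rfl⟩
      rw [hall i hi (by omega)] at hgi
      have := hg.injective hgi
      omega
    · exact heq
    · obtain ⟨i, hi, hfi⟩ := (h (f K)).1 ⟨K, le_rfl, rfl⟩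
      rw [← hall i (by omega) hi] at hfi
      have := hf.injective hfi
      omega
  exact ⟨hKL, fun k hk => hall k hk (hKL ▸ hk)⟩

namespace QuantileIso

variable {Q Q' : QuantileIso} {K K' : ℕ} {p p' : ℕ → ℝ}

lemma zero_eq_of_mixtureCDF_eq (hp : ∀ k ≤ K, 0 < p k) (hp' : ∀ k ≤ K', 0 < p' k)
    (h : ∀ b, Q.mixtureCDF K p b = Q'.mixtureCDF K' p' b) : Q 0 = Q' 0 := by
  have hiff : ∀ b, Q 0 < b ↔ Q' 0 < b := fun b => by
    rw [← Q.mixtureCDF_pos_iff hp, ← Q'.mixtureCDF_pos_iff hp', h]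
  exact le_antisymm (not_lt.1 fun hlt => lt_irrefl _ ((hiff _).2 hlt))
    (not_lt.1 fun hlt => lt_irrefl _ ((hiff _).1 hlt))

lemma mixtureJump_eq (h0 : Q 0 = Q' 0)
    (h : ∀ b, Q.mixtureCDF K p b = Q'.mixtureCDF K' p' b) {b : ℝ} (hb : Q 0 < b) :
    Q.mixtureJump K p b = Q'.mixtureJump K' p' b := by
  obtain ⟨r, h1, h2⟩ := Q.mixtureCDF_one_sided_deriv K p hb
  obtain ⟨r', h1', h2'⟩ := Q'.mixtureCDF_one_sided_deriv K' p' (h0 ▸ hb)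
  rw [funext h] at h1 h2
  have e1 := (uniqueDiffOn_Iic b b self_mem_Iic).eq_deriv _ h1 h1'
  have e2 := (uniqueDiffOn_Ici b b self_mem_Ici).eq_deriv _ h2 h2'
  linarith

lemma zero_lt_bid_one (Q : QuantileIso) (k : ℕ) : Q 0 < Q.bid k 1 := by
  rw [← Q.bid_zero (k := k)]
  exact (Q.bid k).strictMono one_pos

lemma index_eq_and_bid_one_eq (hp : ∀ k ≤ K, 0 < p k) (hp' : ∀ k ≤ K', 0 < p' k)
    (h : ∀ b, Q.mixtureCDF K p b = Q'.mixtureCDF K' p' b) :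
    K = K' ∧ ∀ k ≤ K, Q.bid k 1 = Q'.bid k 1 := by
  have h0 := zero_eq_of_mixtureCDF_eq hp hp' h
  refine eq_of_strictMono_of_image_eq (Q.strictMono_bid_index one_pos)
    (Q'.strictMono_bid_index one_pos) fun b => ?_
  rw [← Q.mixtureJump_ne_zero_iff hp, ← Q'.mixtureJump_ne_zero_iff hp']
  by_cases hb : Q 0 < b
  · rw [mixtureJump_eq h0 h hb]
  · rw [Q.mixtureJump_ne_zero_iff hp, Q'.mixtureJump_ne_zero_iff hp']
    constructor
    · rintro ⟨k, _, rfl⟩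
      exact absurd (Q.zero_lt_bid_one k) hb
    · rintro ⟨k, _, rfl⟩
      exact absurd (h0 ▸ Q'.zero_lt_bid_one k) hb

lemma weight_eq_jump_mul (Q : QuantileIso) (k : ℕ) (x : ℝ) :
    x = x * Q.densityJump k * ((k + 1) / (k + 2)) * (Q 1 - Q.bid k 1) := by
  have := (sub_pos.2 (Q.bid_lt (k := k) one_pos)).ne'
  unfold densityJump
  field_simp

/-- The jumps leave `Q 1` as the only unknown in the weights; requiring the weights to sum to one is
a linear equation for it with positive coefficient `∑ w k`. -/
lemma one_eq_and_weight_eq (hp : ∀ k ≤ K, 0 < p k) (hp' : ∀ k ≤ K, 0 < p' k)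
    (hs : ∑ k ∈ Finset.range (K + 1), p k = 1) (hs' : ∑ k ∈ Finset.range (K + 1), p' k = 1)
    (h : ∀ b, Q.mixtureCDF K p b = Q'.mixtureCDF K p' b) :
    Q 1 = Q' 1 ∧ ∀ k ≤ K, p k = p' k := by
  have h0 := zero_eq_of_mixtureCDF_eq hp hp' h
  have hbid := (index_eq_and_bid_one_eq hp hp' h).2
  have hj : ∀ k ≤ K, p k * Q.densityJump k = p' k * Q'.densityJump k := fun k hk => by
    rw [← Q.mixtureJump_bid p hk, ← Q'.mixtureJump_bid p' hk, ← hbid k hk]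
    exact mixtureJump_eq h0 h (Q.zero_lt_bid_one k)
  -- `w k` is computed from the jump alone, so it is common to both mixtures.
  set w : ℕ → ℝ := fun k => p k * Q.densityJump k * ((k + 1) / (k + 2)) with hw
  have e : ∀ k ≤ K, p k = w k * (Q 1 - Q.bid k 1) := fun k hk => Q.weight_eq_jump_mul k (p k)
  have e' : ∀ k ≤ K, p' k = w k * (Q' 1 - Q.bid k 1) := fun k hk => by
    rw [hw, hbid k hk]
    simp only [hj k hk]
    exact Q'.weight_eq_jump_mul k (p' k)
  have hle : ∀ k ∈ Finset.range (K + 1), k ≤ K := fun k hk => by simp at hk; omega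
  have hdiff : (∑ k ∈ Finset.range (K + 1), w k) * (Q 1 - Q' 1) = 0 := by
    have : ∑ k ∈ Finset.range (K + 1), (p k - p' k) = 0 := by
      rw [Finset.sum_sub_distrib, hs, hs', sub_self]
    rw [← this, Finset.sum_mul]
    refine Finset.sum_congr rfl fun k hk => ?_
    rw [e k (hle k hk), e' k (hle k hk)]
    ring
  have hwpos : 0 < ∑ k ∈ Finset.range (K + 1), w k := by
    refine Finset.sum_pos (fun k hk => ?_) ⟨0, by simp⟩
    have := Q.densityJump_pos (k := k)
    have := hp k (hle k hk)
    simp only [hw]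
    positivity
  have h1 : Q 1 = Q' 1 := by
    rcases mul_eq_zero.1 hdiff with h | h
    · exact absurd h hwpos.ne'
    · linarith
  exact ⟨h1, fun k hk => by rw [e k hk, e' k hk, h1]⟩

/-- The integral of `Q t * ((k + 1) * t ^ k)` over `[0, x]` is the one over `[0, 1]`, which is the
top bid, minus the one over `[x, 1]`. So values of `Q` below `x` are not needed. -/
lemma bid_eq_of_eqOn {a : ℝ} (ha : 0 < a) (h1 : Q.bid k 1 = Q'.bid k 1)
    (hQ : ∀ x ∈ Icc a 1, Q x = Q' x) : ∀ x ∈ Icc a 1, Q.bid k x = Q'.bid k x := by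
  intro x hx
  have key : ∀ R : QuantileIso, x ^ (k + 1) * R.bid k x =
      R.bid k 1 - ∫ t in x..1, R t * ((k + 1) * t ^ k) := by
    intro R
    have hc : Continuous (fun t => R t * ((k + 1) * t ^ k : ℝ)) := by
      have := R.continuous
      fun_prop
    have := intervalIntegral.integral_add_adjacent_intervals
      (hc.intervalIntegrable 0 x (μ := volume))
      (hc.intervalIntegrable x 1)
    rw [bid_apply, bid_apply, pow_mul_bidQuantile, eq_sub_iff_add_eq, this,
      ← pow_mul_bidQuantile]
    simp
  have hxp : 0 < x := ha.trans_le hx.1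
  have hint : ∫ t in x..1, Q t * ((k + 1) * t ^ k) = ∫ t in x..1, Q' t * ((k + 1) * t ^ k) := by
    refine intervalIntegral.integral_congr fun t ht => ?_
    rw [uIcc_of_le hx.2] at ht
    simp only [hQ t ⟨hx.1.trans ht.1, ht.2⟩]
  have := (key Q).trans ((congrArg₂ _ h1 hint).trans (key Q').symm)
  exact mul_left_cancel₀ (pow_pos hxp _).ne' this

lemma maxBidCDF_eq_of_bid_eq {a b : ℝ} (ha : a ≤ 1)
    (hbid : ∀ x ∈ Icc a 1, Q.bid k x = Q'.bid k x) (hb : Q.bid k a ≤ b) :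
    Q.maxBidCDF k b = Q'.maxBidCDF k b := by
  have hle : a ≤ (Q.bid k).symm b := by rwa [OrderIso.le_symm_apply]
  unfold maxBidCDF
  congr 1
  rcases le_total 1 ((Q.bid k).symm b) with h | h
  · have h' : 1 ≤ (Q'.bid k).symm b := by
      rw [OrderIso.le_symm_apply, ← hbid 1 ⟨ha, le_rfl⟩]
      rwa [OrderIso.le_symm_apply] at h
    rw [unitClamp_of_one_le h, unitClamp_of_one_le h']
  · have := hbid _ ⟨hle, h⟩
    rw [OrderIso.apply_symm_apply] at this
    congr 1
    rw [eq_comm, OrderIso.symm_apply_eq]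
    exact this

/-- The continuation step: the component with most bidders has the highest bid at quantile `a`, so
just below that bid it is the only component not yet known. -/
lemma exists_lt_eqOn_Icc (hp : 0 < p K) (hpp : ∀ k ≤ K, p k = p' k)
    (hbid1 : ∀ k ≤ K, Q.bid k 1 = Q'.bid k 1)
    (h : ∀ b, Q.mixtureCDF K p b = Q'.mixtureCDF K p' b) {a : ℝ} (ha0 : 0 < a) (ha1 : a ≤ 1)
    (hQ : ∀ x ∈ Icc a 1, Q x = Q' x) :
    ∃ a' < a, 0 ≤ a' ∧ ∀ x ∈ Ioc a' 1, Q x = Q' x := by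
  have hbid : ∀ k ≤ K, ∀ x ∈ Icc a 1, Q.bid k x = Q'.bid k x := fun k hk =>
    bid_eq_of_eqOn ha0 (hbid1 k hk) hQ
  -- `c` is the second highest bid at quantile `a`, or the lowest value if there is only one
  -- component.
  obtain ⟨c, hc0, hca, hck⟩ : ∃ c, Q 0 ≤ c ∧ c < Q.bid K a ∧ ∀ k < K, Q.bid k a ≤ c := by
    rcases Nat.eq_zero_or_pos K with rfl | hK
    · exact ⟨Q 0, le_rfl, by rw [← Q.bid_zero (k := 0)]; exact (Q.bid 0).strictMono ha0, by simp⟩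
    · refine ⟨Q.bid (K - 1) a, ?_, Q.strictMono_bid_index ha0 (by omega),
        fun k hk => (Q.strictMono_bid_index ha0).monotone (by omega)⟩
      rw [← Q.bid_zero (k := K - 1)]
      exact (Q.bid (K - 1)).monotone ha0.le
  have htop : ∀ b, c ≤ b → Q.maxBidCDF K b = Q'.maxBidCDF K b := by
    intro b hb
    have := h b
    rw [mixtureCDF, mixtureCDF, Finset.sum_range_succ, Finset.sum_range_succ,
      ← hpp K le_rfl] at this
    have hsum : ∑ k ∈ Finset.range K, p k * Q.maxBidCDF k b =
        ∑ k ∈ Finset.range K, p' k * Q'.maxBidCDF k b := by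
      refine Finset.sum_congr rfl fun k hk => ?_
      have hk : k < K := by simpa using hk
      rw [hpp k hk.le, maxBidCDF_eq_of_bid_eq ha1 (hbid k hk.le) ((hck k hk).trans hb)]
    rw [hsum] at this
    exact mul_left_cancel₀ hp.ne' (add_left_cancel this)
  have ha'0 : 0 ≤ (Q.bid K).symm c := by
    rw [OrderIso.le_symm_apply, bid_zero]
    exact hc0
  refine ⟨(Q.bid K).symm c, by rwa [OrderIso.symm_apply_lt], ha'0, ?_⟩
  -- Quantile `1` is left out because `unitClamp` cannot be inverted there.
  have hbK : ∀ x ∈ Ioo ((Q.bid K).symm c) 1, Q.bid K x = Q'.bid K x := by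
    intro x hx
    have hx0 : 0 < x := ha'0.trans_lt hx.1
    have hb : c ≤ Q.bid K x := ((Q.bid K).symm_apply_le.1 hx.1.le)
    have := htop _ hb
    unfold maxBidCDF at this
    rw [pow_left_inj₀ (unitClamp_nonneg _) (unitClamp_nonneg _) (by omega),
      OrderIso.symm_apply_apply, unitClamp_of_mem hx0.le hx.2.le] at this
    have := eq_of_unitClamp_eq hx0 hx.2 this.symm
    rw [OrderIso.symm_apply_eq] at this
    exact this
  intro x hx
  rcases hx.2.eq_or_lt with rfl | hx1
  · exact hQ 1 ⟨ha1, le_rfl⟩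
  have hx0 : 0 < x := ha'0.trans_lt hx.1
  -- Equal bids near `x` have equal derivatives, and the first-order condition then gives equal
  -- values.
  have d1 := Q.hasDerivAt_bid (k := K) hx0
  have d2 := (Q'.hasDerivAt_bid (k := K) hx0).congr_of_eventuallyEq (f₁ := Q.bid K) (by
    filter_upwards [Ioo_mem_nhds hx.1 hx1] with y hy
    exact hbK y hy)
  have := d1.unique d2
  rw [hbK x ⟨hx.1, hx1⟩] at this
  have hk : ((K : ℝ) + 1) ≠ 0 := by positivity
  field_simp at this
  linarith

lemma eqOn_Icc_of_mixtureCDF_eq (hp : 0 < p K) (hpp : ∀ k ≤ K, p k = p' k)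
    (hbid1 : ∀ k ≤ K, Q.bid k 1 = Q'.bid k 1) (h1 : Q 1 = Q' 1)
    (h : ∀ b, Q.mixtureCDF K p b = Q'.mixtureCDF K p' b) :
    ∀ x ∈ Icc (0 : ℝ) 1, Q x = Q' x := by
  -- By continuity the infimum of `S` belongs to `S`; the continuation step excludes a positive
  -- infimum.
  set S : Set ℝ := {a | 0 ≤ a ∧ a ≤ 1 ∧ ∀ x ∈ Icc a 1, Q x = Q' x} with hS
  have hS1 : (1 : ℝ) ∈ S := ⟨zero_le_one, le_rfl, fun x hx => by
    rw [le_antisymm hx.2 hx.1, h1]⟩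
  have hSb : BddBelow S := ⟨0, fun a ha => ha.1⟩
  have hclosure : ∀ a, 0 ≤ a → a ≤ 1 → (∀ x ∈ Ioc a 1, Q x = Q' x) → a ∈ S := by
    intro a h0 h1' hx
    refine ⟨h0, h1', fun x hxa => ?_⟩
    rcases h1'.eq_or_lt with rfl | hlt
    · rw [le_antisymm hxa.2 hxa.1, h1]
    have : EqOn Q Q' (closure (Ioc a 1)) :=
      EqOn.closure (fun x hx' => hx x hx') Q.continuous Q'.continuous
    rw [closure_Ioc hlt.ne] at this
    exact this hxa
  have hmem : sInf S ∈ S := by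
    refine hclosure _ (le_csInf ⟨1, hS1⟩ fun a ha => ha.1) (csInf_le hSb hS1) fun x hx => ?_
    obtain ⟨a, ha, hax⟩ := exists_lt_of_csInf_lt ⟨1, hS1⟩ hx.1
    exact ha.2.2 x ⟨hax.le, hx.2⟩
  have hzero : sInf S = 0 := by
    by_contra hne
    have hpos : 0 < sInf S := lt_of_le_of_ne hmem.1 (Ne.symm hne)
    obtain ⟨a', hlt, ha0, hx⟩ := exists_lt_eqOn_Icc hp hpp hbid1 h hpos hmem.2.1 hmem.2.2
    exact absurd (csInf_le hSb (hclosure a' ha0 (hlt.le.trans hmem.2.1) hx)) (not_le.2 hlt)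
  rw [hzero] at hmem
  exact hmem.2.2

/-- The mixture of the c.d.f.s of the highest bids determines the number of its components, their
weights and the quantile function. -/
theorem mixtureCDF_identification (hp : ∀ k ≤ K, 0 < p k) (hp' : ∀ k ≤ K', 0 < p' k)
    (hs : ∑ k ∈ Finset.range (K + 1), p k = 1) (hs' : ∑ k ∈ Finset.range (K' + 1), p' k = 1)
    (h : ∀ b, Q.mixtureCDF K p b = Q'.mixtureCDF K' p' b) :
    K = K' ∧ (∀ k ≤ K, p k = p' k) ∧ ∀ x ∈ Icc (0 : ℝ) 1, Q x = Q' x := by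
  obtain ⟨rfl, hbid1⟩ := index_eq_and_bid_one_eq hp hp' h
  obtain ⟨h1, hpp⟩ := one_eq_and_weight_eq hp hp' hs hs' h
  exact ⟨rfl, hpp, eqOn_Icc_of_mixtureCDF_eq (hp K le_rfl) hpp hbid1 h1 h⟩

end QuantileIso

/-! ### Regular value distributions and their quantile functions. -/

/-- A probability law whose c.d.f. is continuous and increases strictly from `0` to `1` on
`[lo, hi]`. -/
structure IsRegularLaw (μ : Measure ℝ) (lo hi : ℝ) : Prop where
  isProbabilityMeasure : IsProbabilityMeasure μ
  lt : lo < hi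
  continuous : Continuous (cdf μ)
  strictMonoOn : StrictMonoOn (cdf μ) (Icc lo hi)
  cdf_lo : cdf μ lo = 0
  cdf_hi : cdf μ hi = 1

namespace IsRegularLaw

variable {μ : Measure ℝ} {lo hi : ℝ}

lemma cdf_of_le (h : IsRegularLaw μ lo hi) {v : ℝ} (hv : v ≤ lo) : cdf μ v = 0 :=
  le_antisymm (h.cdf_lo ▸ monotone_cdf μ hv) (cdf_nonneg μ v)

lemma cdf_of_ge (h : IsRegularLaw μ lo hi) {v : ℝ} (hv : hi ≤ v) : cdf μ v = 1 :=
  le_antisymm (cdf_le_one μ v) (h.cdf_hi ▸ monotone_cdf μ hv)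

lemma ae_mem_Ioc (h : IsRegularLaw μ lo hi) : ∀ᵐ v ∂μ, v ∈ Ioc lo hi := by
  have := h.isProbabilityMeasure
  have h1 : μ (Iic lo) = 0 := by
    have := h.cdf_lo
    rwa [cdf_eq_real, measureReal_eq_zero_iff] at this
  have h2 : μ (Iic hi)ᶜ = 0 := by
    have := h.cdf_hi
    rw [prob_compl_eq_zero_iff measurableSet_Iic]
    rw [cdf_eq_real, measureReal_def] at this
    rw [← ENNReal.ofReal_toReal (measure_ne_top μ (Iic hi)), this, ENNReal.ofReal_one]
  have e1 : ∀ᵐ v ∂μ, v ∉ Iic lo := measure_eq_zero_iff_ae_notMem.1 h1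
  have e2 : ∀ᵐ v ∂μ, v ∉ (Iic hi)ᶜ := measure_eq_zero_iff_ae_notMem.1 h2
  filter_upwards [e1, e2] with v hv1 hv2
  simp only [mem_Iic, not_le, mem_compl_iff] at hv1 hv2
  exact ⟨hv1, not_lt.1 hv2⟩

/-- The c.d.f., made into a strictly increasing function of slope one outside `[lo, hi]`. -/
noncomputable def extCDF (μ : Measure ℝ) (lo hi v : ℝ) : ℝ :=
  cdf μ v + min (v - lo) 0 + max (v - hi) 0

lemma strictMono_extCDF (h : IsRegularLaw μ lo hi) : StrictMono (extCDF μ lo hi) := by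
  intro v w hvw
  have h1 := monotone_cdf μ hvw.le
  have h2 : min (v - lo) 0 ≤ min (w - lo) 0 := min_le_min_right _ (by linarith)
  have h3 : max (v - hi) 0 ≤ max (w - hi) 0 := max_le_max_right _ (by linarith)
  unfold extCDF
  rcases lt_or_ge v lo with hv | hv
  · have : min (v - lo) 0 < min (w - lo) 0 := by
      rw [min_eq_left (by linarith)]
      exact lt_min (by linarith) (by linarith)
    linarith
  rcases lt_or_ge hi w with hw | hw
  · have : max (v - hi) 0 < max (w - hi) 0 := by
      rw [max_eq_left (a := w - hi) (by linarith)]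
      exact max_lt (by linarith) (by linarith)
    linarith
  have := h.strictMonoOn ⟨hv, hvw.le.trans hw⟩ ⟨hv.trans hvw.le, hw⟩ hvw
  linarith

lemma abs_extCDF_sub_le (μ : Measure ℝ) (lo hi v : ℝ) (hlt : lo < hi) :
    |extCDF μ lo hi v - v| ≤ 1 + |lo| + |hi| := by
  have h0 := cdf_nonneg μ v
  have h1 := cdf_le_one μ v
  have := neg_abs_le lo
  have := le_abs_self lo
  have := neg_abs_le hi
  have := le_abs_self hi
  unfold extCDF
  rw [abs_le]
  rcases min_cases (v - lo) 0 with ⟨e1, _⟩ | ⟨e1, _⟩ <;>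
  rcases max_cases (v - hi) 0 with ⟨e2, _⟩ | ⟨e2, _⟩ <;>
  rw [e1, e2] <;> constructor <;> linarith [abs_nonneg lo, abs_nonneg hi]

lemma surjective_extCDF (h : IsRegularLaw μ lo hi) : Function.Surjective (extCDF μ lo hi) := by
  have hC := fun v => abs_le.1 (abs_extCDF_sub_le μ lo hi v h.lt)
  have hc : Continuous (extCDF μ lo hi) := by
    have := h.continuous
    unfold extCDF
    fun_prop
  refine hc.surjective ?_ ?_
  · refine Filter.tendsto_atTop_mono (f := fun x => x + -(1 + |lo| + |hi|))
      (fun x => by linarith [(hC x).1]) ?_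
    exact Filter.tendsto_atTop_add_const_right _ _ Filter.tendsto_id
  · refine Filter.tendsto_atBot_mono (f := fun x => x + (1 + |lo| + |hi|))
      (fun x => by linarith [(hC x).2]) ?_
    exact Filter.tendsto_atBot_add_const_right _ _ Filter.tendsto_id

/-- The quantile function of a regular law, extended to the real line. -/
noncomputable def quantileIso (h : IsRegularLaw μ lo hi) : QuantileIso where
  toOrderIso := (h.strictMono_extCDF.orderIsoOfSurjective _ h.surjective_extCDF).symm
  bounded := ⟨1 + |lo| + |hi|, fun x => by
    obtain ⟨v, rfl⟩ := h.surjective_extCDF x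
    have : (h.strictMono_extCDF.orderIsoOfSurjective _ h.surjective_extCDF).symm
        (extCDF μ lo hi v) = v :=
      (h.strictMono_extCDF.orderIsoOfSurjective _ h.surjective_extCDF).symm_apply_apply v
    rw [this, abs_sub_comm]
    exact abs_extCDF_sub_le μ lo hi v h.lt⟩

lemma quantileIso_symm_apply (h : IsRegularLaw μ lo hi) (v : ℝ) :
    h.quantileIso.toOrderIso.symm v = extCDF μ lo hi v := rfl

lemma quantileIso_zero (h : IsRegularLaw μ lo hi) : h.quantileIso 0 = lo := by
  have := h.lt
  rw [eq_comm, ← OrderIso.symm_apply_eq, quantileIso_symm_apply, extCDF, h.cdf_lo,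
    max_eq_right (by linarith)]
  simp

lemma quantileIso_one (h : IsRegularLaw μ lo hi) : h.quantileIso 1 = hi := by
  have := h.lt
  rw [eq_comm, ← OrderIso.symm_apply_eq, quantileIso_symm_apply, extCDF, h.cdf_hi,
    min_eq_right (by linarith)]
  simp

lemma cdf_eq_unitClamp (h : IsRegularLaw μ lo hi) (v : ℝ) :
    cdf μ v = unitClamp (h.quantileIso.toOrderIso.symm v) := by
  rcases le_total v lo with hv | hv
  · rw [unitClamp_of_nonpos, h.cdf_of_le hv]
    rw [OrderIso.symm_apply_le, h.quantileIso_zero]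
    exact hv
  rcases le_total hi v with hv' | hv'
  · rw [unitClamp_of_one_le, h.cdf_of_ge hv']
    rw [OrderIso.le_symm_apply, h.quantileIso_one]
    exact hv'
  have : h.quantileIso.toOrderIso.symm v = cdf μ v := by
    rw [quantileIso_symm_apply, extCDF, min_eq_right (by linarith), max_eq_right (by linarith)]
    ring
  rw [this, unitClamp_of_mem (cdf_nonneg μ v) (cdf_le_one μ v)]

lemma cdf_quantileIso (h : IsRegularLaw μ lo hi) (a : ℝ) :
    cdf μ (h.quantileIso a) = unitClamp a := by
  rw [h.cdf_eq_unitClamp, OrderIso.symm_apply_apply]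

lemma quantileIso_mem_Icc (h : IsRegularLaw μ lo hi) {a : ℝ} (ha : a ∈ Icc (0 : ℝ) 1) :
    h.quantileIso a ∈ Icc lo hi := by
  have h0 := h.quantileIso.strictMono.monotone ha.1
  have h1 := h.quantileIso.strictMono.monotone ha.2
  rw [h.quantileIso_zero] at h0
  rw [h.quantileIso_one] at h1
  exact ⟨h0, h1⟩

lemma cdf_eq_of_quantileIso_eqOn {μ' : Measure ℝ} {lo' hi' : ℝ} (h : IsRegularLaw μ lo hi)
    (h' : IsRegularLaw μ' lo' hi')
    (heq : ∀ x ∈ Icc (0 : ℝ) 1, h.quantileIso x = h'.quantileIso x) (v : ℝ) :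
    cdf μ v = cdf μ' v := by
  have hlo : lo = lo' := by
    rw [← h.quantileIso_zero, ← h'.quantileIso_zero, heq 0 (by simp)]
  have hhi : hi = hi' := by
    rw [← h.quantileIso_one, ← h'.quantileIso_one, heq 1 (by simp)]
  subst hlo hhi
  rcases le_total v lo with hv | hv
  · rw [h.cdf_of_le hv, h'.cdf_of_le hv]
  rcases le_total hi v with hv' | hv'
  · rw [h.cdf_of_ge hv', h'.cdf_of_ge hv']
  obtain ⟨a, rfl⟩ := h.quantileIso.toOrderIso.surjective v
  have ha : a ∈ Icc (0 : ℝ) 1 := by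
    constructor
    · rw [← h.quantileIso.toOrderIso.le_iff_le, h.quantileIso_zero]
      exact hv
    · rw [← h.quantileIso.toOrderIso.le_iff_le, h.quantileIso_one]
      exact hv'
  rw [h.cdf_quantileIso, heq a ha, h'.cdf_quantileIso]

end IsRegularLaw

/-! ### Equilibrium bids and profits in the first-price auction. -/

namespace IsBiddingEquilibrium

variable {μ : Measure ℝ} {lo hi : ℝ} {n k : ℕ} {β : ℝ → ℝ}

lemma winProb_bid (hμ : IsRegularLaw μ lo hi) (hβ : IsBiddingEquilibrium μ lo hi n β)
    (hn : 2 ≤ n) (m : ℕ) {v : ℝ} (hv : v ∈ Icc lo hi) : winProb μ β m (β v) = cdf μ v ^ m := by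
  have := hμ.isProbabilityMeasure
  rw [winProb, cdf_eq_real]
  congr 1
  refine measureReal_congr ?_
  filter_upwards [hμ.ae_mem_Ioc] with w hw
  exact propext ((hβ.strictMono hn).le_iff_le (Ioc_subset_Icc_self hw) hv)

lemma bid_quantile (hμ : IsRegularLaw μ lo hi) (hβ : IsBiddingEquilibrium μ lo hi (k + 2) β)
    {a : ℝ} (ha0 : 0 < a) (ha1 : a ≤ 1) : β (hμ.quantileIso a) = hμ.quantileIso.bid k a := by
  have hQ := hμ.quantileIso.continuous
  -- Value quantile `x` does not gain by bidding like quantile `y`. The envelope theorem applies to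
  -- the expected payment, which vanishes at quantile `0` because winning there has probability
  -- zero.
  have h : ∀ x ∈ Icc 0 a, ∀ y ∈ Icc 0 a,
      x ^ (k + 1) * β (hμ.quantileIso x) - y ^ (k + 1) * β (hμ.quantileIso y) ≤
        hμ.quantileIso x * (x ^ (k + 1) - y ^ (k + 1)) := by
    intro x hx y hy
    have hx' := hμ.quantileIso_mem_Icc ⟨hx.1, hx.2.trans ha1⟩
    have hy' := hμ.quantileIso_mem_Icc ⟨hy.1, hy.2.trans ha1⟩
    have := hβ.bestResponse _ hx' _ (hβ.nonneg _ hy')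
    rw [hβ.winProb_bid hμ (by omega) _ hx', hβ.winProb_bid hμ (by omega) _ hy',
      hμ.cdf_quantileIso, hμ.cdf_quantileIso, unitClamp_of_mem hx.1 (hx.2.trans ha1),
      unitClamp_of_mem hy.1 (hy.2.trans ha1), show k + 2 - 1 = k + 1 from rfl] at this
    linarith
  have h2 := integral_of_increment_le ha0.le (φ := fun x => x ^ (k + 1))
    (φ' := fun x => (k + 1) * x ^ k) (q := hμ.quantileIso)
    (U := fun x => x ^ (k + 1) * β (hμ.quantileIso x)) h hQ.continuousOn
    (fun x => by simpa using hasDerivAt_pow (k + 1) x) (by fun_prop)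
  rw [← pow_mul_bidQuantile] at h2
  simp only [ne_eq, Nat.add_eq_zero_iff, one_ne_zero, and_false, not_false_eq_true, zero_pow,
    zero_mul, sub_zero] at h2
  exact (mul_left_cancel₀ (pow_pos ha0 _).ne' h2).symm

lemma measureReal_bid_le (hμ : IsRegularLaw μ lo hi) (hβ : IsBiddingEquilibrium μ lo hi (k + 2) β)
    (b : ℝ) : μ.real {w | β w ≤ b} = unitClamp ((hμ.quantileIso.bid k).symm b) := by
  have := hμ.isProbabilityMeasure
  rw [← hμ.cdf_quantileIso, cdf_eq_real]
  refine measureReal_congr ?_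
  filter_upwards [hμ.ae_mem_Ioc] with w hw
  refine propext ?_
  obtain ⟨a, rfl⟩ := hμ.quantileIso.toOrderIso.surjective w
  have ha0 : 0 < a := by
    rw [← hμ.quantileIso.toOrderIso.lt_iff_lt, hμ.quantileIso_zero]
    exact hw.1
  have ha1 : a ≤ 1 := by
    rw [← hμ.quantileIso.toOrderIso.le_iff_le, hμ.quantileIso_one]
    exact hw.2
  change β (hμ.quantileIso a) ≤ b ↔
    hμ.quantileIso.toOrderIso a ≤ hμ.quantileIso.toOrderIso ((hμ.quantileIso.bid k).symm b)
  rw [hβ.bid_quantile hμ ha0 ha1, OrderIso.le_iff_le, OrderIso.le_symm_apply]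

lemma profit_eq (hμ : IsRegularLaw μ lo hi) (hβ : IsBiddingEquilibrium μ lo hi n β)
    (hn : 2 ≤ n) {v : ℝ} (hv : v ∈ Icc lo hi) :
    (v - β v) * winProb μ β (n - 1) (β v) = ∫ x in lo..v, cdf μ x ^ (n - 1) := by
  -- The same incentive constraints, now for the profit as a function of the value: its slope is the
  -- probability of winning.
  have h : ∀ x ∈ Icc lo v, ∀ y ∈ Icc lo v,
      (x - β x) * cdf μ x ^ (n - 1) - (y - β y) * cdf μ y ^ (n - 1) ≤
        cdf μ x ^ (n - 1) * (x - y) := by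
    intro x hx y hy
    have hx' : x ∈ Icc lo hi := ⟨hx.1, hx.2.trans hv.2⟩
    have hy' : y ∈ Icc lo hi := ⟨hy.1, hy.2.trans hv.2⟩
    have := hβ.bestResponse y hy' _ (hβ.nonneg x hx')
    rw [hβ.winProb_bid hμ hn _ hx', hβ.winProb_bid hμ hn _ hy'] at this
    linarith
  have hc := hμ.continuous
  have h2 := integral_of_increment_le hv.1 (φ := fun x => x) (φ' := fun _ => 1)
    (q := fun x => cdf μ x ^ (n - 1)) (U := fun x => (x - β x) * cdf μ x ^ (n - 1)) h
    (by fun_prop) (fun x => hasDerivAt_id x) continuous_const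
  simp only [mul_one] at h2
  rw [h2, hβ.winProb_bid hμ hn _ hv, hμ.cdf_lo, zero_pow (by omega)]
  ring

lemma bid_eq_zero (hβ : IsBiddingEquilibrium μ lo hi 1 β) {v : ℝ} (hv : v ∈ Icc lo hi) :
    β v = 0 := by
  have h1 := hβ.bestResponse v hv 0 le_rfl
  have h2 := hβ.nonneg v hv
  simp only [winProb, Nat.sub_self, pow_zero, mul_one] at h1
  linarith

end IsBiddingEquilibrium

/-- Linear bounds on the increments are preserved by averaging over signals, so this criterion
serves both `valueLaw s` and `entrantLaw s`. -/
lemma IsRegularLaw.of_increments {μ : Measure ℝ} [IsProbabilityMeasure μ] {lo hi ε C : ℝ}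
    (hlt : lo < hi) (h0 : cdf μ lo = 0) (h1 : cdf μ hi = 1) (hε : 0 < ε)
    (h : ∀ v ∈ Icc lo hi, ∀ w ∈ Icc lo hi, v ≤ w →
      ε * (w - v) ≤ cdf μ w - cdf μ v ∧ cdf μ w - cdf μ v ≤ C * (w - v)) :
    IsRegularLaw μ lo hi where
  isProbabilityMeasure := inferInstance
  lt := hlt
  cdf_lo := h0
  cdf_hi := h1
  strictMonoOn := by
    intro v hv w hw hvw
    have := (h v hv w hw hvw.le).1
    have := mul_pos hε (sub_pos.2 hvw)
    linarith
  continuous := by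
    have hproj : cdf μ = fun v => cdf μ (projIcc lo hi hlt.le v) := by
      ext v
      rcases le_total v lo with hv | hv
      · rw [projIcc_of_le_left hlt.le hv, h0]
        exact le_antisymm (h0 ▸ monotone_cdf μ hv) (cdf_nonneg μ v)
      rcases le_total hi v with hv' | hv'
      · rw [projIcc_of_right_le hlt.le hv', h1]
        exact le_antisymm (cdf_le_one μ v) (h1 ▸ monotone_cdf μ hv')
      · rw [projIcc_of_mem hlt.le ⟨hv, hv'⟩]
    have hC : ∀ v ∈ Icc lo hi, ∀ w ∈ Icc lo hi, v ≤ w → cdf μ w - cdf μ v ≤ |C| * (w - v) :=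
      fun v hv w hw hvw => (h v hv w hw hvw).2.trans
        (mul_le_mul_of_nonneg_right (le_abs_self C) (sub_nonneg.2 hvw))
    have hlip : LipschitzOnWith (Real.nnabs C) (cdf μ) (Icc lo hi) := by
      refine LipschitzOnWith.of_dist_le_mul fun v hv w hw => ?_
      rw [Real.dist_eq, Real.dist_eq, Real.coe_nnabs]
      rcases le_total v w with hvw | hvw
      · rw [abs_sub_comm, abs_sub_comm v, abs_of_nonneg (sub_nonneg.2 (monotone_cdf μ hvw)),
          abs_of_nonneg (sub_nonneg.2 hvw)]
        exact hC v hv w hw hvw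
      · rw [abs_of_nonneg (sub_nonneg.2 (monotone_cdf μ hvw)), abs_of_nonneg (sub_nonneg.2 hvw)]
        exact hC w hw v hv hvw
    rw [hproj]
    exact hlip.continuousOn.comp_continuous (continuous_subtype_val.comp continuous_projIcc)
      fun v => (projIcc lo hi hlt.le v).2

/-! ### Values given the signal and given entry. -/

namespace EntryModel

variable {E : Type*} {M : EntryModel E}

instance isProbabilityMeasure_restrict_unit :
    IsProbabilityMeasure (volume.restrict (Icc (0 : ℝ) 1)) := ⟨by simp⟩

lemma isProbabilityMeasure_jointLaw (hκ : IsMarkovKernel M.valueLaw) :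
    IsProbabilityMeasure M.jointLaw := by
  unfold jointLaw
  infer_instance

lemma measurable_valueLaw_real {A : Set ℝ} (hA : MeasurableSet A) :
    Measurable (fun t => (M.valueLaw t).real A) :=
  (M.valueLaw.measurable_coe hA).ennreal_toReal

lemma intervalIntegrable_valueLaw_real (hκ : IsMarkovKernel M.valueLaw) {A : Set ℝ}
    (hA : MeasurableSet A) (a b : ℝ) :
    IntervalIntegrable (fun t => (M.valueLaw t).real A) volume a b := by
  refine (intervalIntegrable_const (c := (1 : ℝ))).mono_fun
    (measurable_valueLaw_real hA).aestronglyMeasurable (.of_forall fun t => ?_)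
  dsimp only
  rw [Real.norm_of_nonneg measureReal_nonneg, norm_one]
  exact measureReal_le_one

lemma jointLaw_real_Ici_prod (hκ : IsMarkovKernel M.valueLaw) {s : ℝ} (hs : s ∈ Ioo (0 : ℝ) 1)
    {A : Set ℝ} (hA : MeasurableSet A) :
    M.jointLaw.real (Ici s ×ˢ A) = ∫ t in s..1, (M.valueLaw t).real A := by
  rw [measureReal_def, jointLaw, Measure.compProd_apply_prod measurableSet_Ici hA,
    Measure.restrict_restrict measurableSet_Ici, show Ici s ∩ Icc 0 1 = Icc s 1 by
      ext x
      simp only [mem_inter_iff, mem_Ici, mem_Icc]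
      have := hs.1
      constructor
      · rintro ⟨h1, h2⟩
        exact ⟨h1, h2.2⟩
      · rintro ⟨h1, h2⟩
        exact ⟨h1, by linarith, h2⟩,
    intervalIntegral.integral_of_le hs.2.le, ← integral_Icc_eq_integral_Ioc]
  refine (integral_toReal (M.valueLaw.measurable_coe hA).aemeasurable
    (.of_forall fun t => measure_lt_top _ _)).symm

lemma jointLaw_real_Ici (hκ : IsMarkovKernel M.valueLaw) {s : ℝ} (hs : s ∈ Ioo (0 : ℝ) 1) :
    M.jointLaw.real (Ici s ×ˢ univ) = 1 - s := by
  rw [jointLaw_real_Ici_prod hκ hs MeasurableSet.univ]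
  simp

lemma isProbabilityMeasure_entrantLaw (hκ : IsMarkovKernel M.valueLaw) {s : ℝ}
    (hs : s ∈ Ioo (0 : ℝ) 1) : IsProbabilityMeasure (M.entrantLaw s) := by
  have := isProbabilityMeasure_jointLaw hκ
  have hne : M.jointLaw {p | s ≤ p.1} ≠ 0 := by
    have h := jointLaw_real_Ici hκ hs
    have he : (Ici s ×ˢ univ : Set (ℝ × ℝ)) = {p | s ≤ p.1} := by
      ext p
      simp
    rw [he] at h
    intro h0
    rw [measureReal_def, h0] at h
    simp at h
    linarith [hs.2]
  have := cond_isProbabilityMeasure hne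
  exact Measure.isProbabilityMeasure_map measurable_snd.aemeasurable

lemma entrantLaw_real (hκ : IsMarkovKernel M.valueLaw) {s : ℝ} (hs : s ∈ Ioo (0 : ℝ) 1)
    {A : Set ℝ} (hA : MeasurableSet A) :
    (1 - s) * (M.entrantLaw s).real A = M.jointLaw.real (Ici s ×ˢ A) := by
  have hE : {p : ℝ × ℝ | s ≤ p.1} = Ici s ×ˢ univ := by
    ext p
    simp
  have hEA : (Ici s ×ˢ univ : Set (ℝ × ℝ)) ∩ Prod.snd ⁻¹' A = Ici s ×ˢ A := by
    ext p
    simp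
  rw [entrantLaw, map_measureReal_apply measurable_snd hA, hE, measureReal_def,
    cond_apply (measurableSet_Ici.prod MeasurableSet.univ), hEA, ENNReal.toReal_mul,
    ENNReal.toReal_inv, ← measureReal_def, ← measureReal_def, jointLaw_real_Ici hκ hs]
  have : 1 - s ≠ 0 := by linarith [hs.2]
  field_simp

lemma F_eq_real (hκ : IsMarkovKernel M.valueLaw) (v s : ℝ) :
    M.F v s = (M.valueLaw s).real (Iic v) := by
  rw [F, cdf_eq_real]

lemma Fc_eq_integral (hκ : IsMarkovKernel M.valueLaw) {s : ℝ} (hs : s ∈ Ioo (0 : ℝ) 1) (v : ℝ) :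
    (1 - s) * M.Fc v s = ∫ t in s..1, M.F v t := by
  have := isProbabilityMeasure_entrantLaw hκ hs
  rw [Fc, cdf_eq_real, entrantLaw_real hκ hs measurableSet_Iic,
    jointLaw_real_Ici_prod hκ hs measurableSet_Iic]
  simp only [F_eq_real hκ]

lemma intervalIntegrable_F (hκ : IsMarkovKernel M.valueLaw) (v a b : ℝ) :
    IntervalIntegrable (M.F v) volume a b := by
  have := intervalIntegrable_valueLaw_real hκ (measurableSet_Iic (a := v)) a b
  simpa only [← F_eq_real hκ] using this

namespace AssumptionE

variable [TopologicalSpace E] {Z : Set E}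

/-- Projecting both arguments onto their intervals extends the density to a bounded, globally
continuous function without changing the laws. -/
lemma exists_density (hM : M.AssumptionE Z) : ∃ f : ℝ → ℝ → ℝ, ∃ ε C : ℝ,
    Continuous (Function.uncurry f) ∧ 0 < ε ∧ (∀ v s, ε ≤ f v s) ∧ (∀ v s, f v s ≤ C) ∧
    ∀ s ∈ Icc (0 : ℝ) 1, M.valueLaw s =
      (volume.restrict (Icc M.vlo M.vhi)).withDensity (fun v => ENNReal.ofReal (f v s)) := by
  obtain ⟨f, hf, ⟨ε, hε, hle⟩, hlaw⟩ := hM.density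
  have hlt := hM.vlo_lt_vhi.le
  obtain ⟨C, hC⟩ := (isCompact_Icc.prod isCompact_Icc).exists_bound_of_continuousOn hf
  refine ⟨fun v s => f (projIcc M.vlo M.vhi hlt v) (projIcc 0 1 zero_le_one s), ε, C, ?_, hε,
    fun v s => hle _ (Subtype.mem _) _ (Subtype.mem _), fun v s => ?_, fun s hs => ?_⟩
  · have hg : Continuous (fun x : ℝ × ℝ =>
        ((projIcc M.vlo M.vhi hlt x.1 : ℝ), (projIcc 0 1 zero_le_one x.2 : ℝ))) := by
      have h1 : Continuous (projIcc M.vlo M.vhi hlt) := continuous_projIcc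
      have h2 : Continuous (projIcc (0 : ℝ) 1 zero_le_one) := continuous_projIcc
      fun_prop
    exact hf.comp_continuous hg fun x => ⟨Subtype.mem _, Subtype.mem _⟩
  · exact (le_abs_self _).trans (hC (_, _) ⟨Subtype.mem (projIcc M.vlo M.vhi hlt v),
      Subtype.mem (projIcc 0 1 zero_le_one s)⟩)
  · rw [hlaw s hs]
    refine withDensity_congr_ae ?_
    filter_upwards [ae_restrict_mem measurableSet_Icc] with v hv
    rw [projIcc_of_mem hlt hv, projIcc_of_mem zero_le_one hs]

lemma F_eq_integral (hM : M.AssumptionE Z) {f : ℝ → ℝ → ℝ} (hf : Continuous (Function.uncurry f))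
    (h0 : ∀ v s, 0 ≤ f v s)
    (hlaw : ∀ s ∈ Icc (0 : ℝ) 1, M.valueLaw s =
      (volume.restrict (Icc M.vlo M.vhi)).withDensity (fun v => ENNReal.ofReal (f v s)))
    {s v : ℝ} (hs : s ∈ Icc (0 : ℝ) 1) (hv : v ∈ Icc M.vlo M.vhi) :
    M.F v s = ∫ x in M.vlo..v, f x s := by
  have hfs : Continuous (fun x => f x s) := by
    have : Continuous (fun x : ℝ => (x, s)) := by fun_prop
    exact hf.comp this
  rw [F_eq_real hM.markov, hlaw s hs, measureReal_def, withDensity_apply _ measurableSet_Iic,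
    Measure.restrict_restrict measurableSet_Iic, show Iic v ∩ Icc M.vlo M.vhi = Icc M.vlo v by
      ext x
      simp only [mem_inter_iff, mem_Iic, mem_Icc]
      constructor
      · rintro ⟨h1, h2⟩
        exact ⟨h2.1, h1⟩
      · rintro ⟨h1, h2⟩
        exact ⟨h2, h1, h2.trans hv.2⟩,
    intervalIntegral.integral_of_le hv.1, ← integral_Icc_eq_integral_Ioc,
    integral_eq_lintegral_of_nonneg_ae (.of_forall fun x => h0 x s) hfs.aestronglyMeasurable]

lemma F_vlo (hM : M.AssumptionE Z) {s : ℝ} (hs : s ∈ Icc (0 : ℝ) 1) : M.F M.vlo s = 0 := by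
  obtain ⟨f, ε, C, hf, hε, hle, -, hlaw⟩ := hM.exists_density
  rw [hM.F_eq_integral hf (fun v s => hε.le.trans (hle v s)) hlaw hs
    ⟨le_rfl, hM.vlo_lt_vhi.le⟩, intervalIntegral.integral_same]

lemma F_vhi (hM : M.AssumptionE Z) {s : ℝ} (hs : s ∈ Icc (0 : ℝ) 1) : M.F M.vhi s = 1 := by
  obtain ⟨f, ε, C, hf, hε, hle, -, hlaw⟩ := hM.exists_density
  have := hM.markov
  have h : (M.valueLaw s) (Iic M.vhi)ᶜ = 0 := by
    rw [hlaw s hs, withDensity_apply _ measurableSet_Iic.compl,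
      Measure.restrict_restrict measurableSet_Iic.compl,
      show (Iic M.vhi)ᶜ ∩ Icc M.vlo M.vhi = ∅ by ext x; simp; grind]
    simp
  rw [F_eq_real hM.markov, measureReal_def, (prob_compl_eq_zero_iff measurableSet_Iic).1 h,
    ENNReal.toReal_one]

lemma exists_F_increments (hM : M.AssumptionE Z) : ∃ ε C : ℝ, 0 < ε ∧ ∀ s ∈ Icc (0 : ℝ) 1,
    ∀ v ∈ Icc M.vlo M.vhi, ∀ w ∈ Icc M.vlo M.vhi, v ≤ w →
      ε * (w - v) ≤ M.F w s - M.F v s ∧ M.F w s - M.F v s ≤ C * (w - v) := by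
  obtain ⟨f, ε, C, hf, hε, hle, hC, hlaw⟩ := hM.exists_density
  refine ⟨ε, C, hε, fun s hs v hv w hw hvw => ?_⟩
  have hfs : Continuous (fun x => f x s) := by
    have : Continuous (fun x : ℝ => (x, s)) := by fun_prop
    exact hf.comp this
  have h0 : ∀ v s, 0 ≤ f v s := fun v s => hε.le.trans (hle v s)
  rw [hM.F_eq_integral hf h0 hlaw hs hv, hM.F_eq_integral hf h0 hlaw hs hw,
    intervalIntegral.integral_interval_sub_left (hfs.intervalIntegrable _ _)
      (hfs.intervalIntegrable _ _)]
  have e1 : ∫ _ in v..w, ε = ε * (w - v) := by simp [mul_comm]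
  have e2 : ∫ _ in v..w, C = C * (w - v) := by simp [mul_comm]
  rw [← e1, ← e2]
  exact ⟨intervalIntegral.integral_mono_on hvw (by simp) (hfs.intervalIntegrable _ _)
      fun x _ => hle x s,
    intervalIntegral.integral_mono_on hvw (hfs.intervalIntegrable _ _) (by simp)
      fun x _ => hC x s⟩

lemma isRegularLaw_valueLaw (hM : M.AssumptionE Z) {s : ℝ} (hs : s ∈ Icc (0 : ℝ) 1) :
    IsRegularLaw (M.valueLaw s) M.vlo M.vhi := by
  obtain ⟨ε, C, hε, h⟩ := hM.exists_F_increments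
  have := hM.markov
  exact .of_increments hM.vlo_lt_vhi (hM.F_vlo hs) (hM.F_vhi hs) hε (h s hs)

lemma isRegularLaw_entrantLaw (hM : M.AssumptionE Z) {s : ℝ} (hs : s ∈ Ioo (0 : ℝ) 1) :
    IsRegularLaw (M.entrantLaw s) M.vlo M.vhi := by
  obtain ⟨ε, C, hε, h⟩ := hM.exists_F_increments
  have hκ := hM.markov
  have := isProbabilityMeasure_entrantLaw hκ hs
  have h1s : 0 < 1 - s := by linarith [hs.2]
  have hsub : ∀ t ∈ Icc s 1, t ∈ Icc (0 : ℝ) 1 := fun t ht => ⟨hs.1.le.trans ht.1, ht.2⟩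
  have hFc := fun v => Fc_eq_integral hκ hs v
  refine .of_increments hM.vlo_lt_vhi ?_ ?_ hε (C := C) fun v hv w hw hvw => ?_
  · have := hFc M.vlo
    rw [intervalIntegral.integral_congr (g := fun _ => (0 : ℝ)) fun t ht => hM.F_vlo (hsub t
      (by rwa [uIcc_of_le hs.2.le] at ht))] at this
    simp only [intervalIntegral.integral_zero, mul_eq_zero] at this
    exact this.resolve_left h1s.ne'
  · have := hFc M.vhi
    rw [intervalIntegral.integral_congr (g := fun _ => (1 : ℝ)) fun t ht => hM.F_vhi (hsub t
      (by rwa [uIcc_of_le hs.2.le] at ht))] at this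
    simp only [intervalIntegral.integral_const, smul_eq_mul, mul_one] at this
    exact mul_left_cancel₀ h1s.ne' (this.trans (mul_one _).symm)
  · have hdiff : (1 - s) * (M.Fc w s - M.Fc v s) = ∫ t in s..1, (M.F w t - M.F v t) := by
      rw [mul_sub, hFc, hFc, intervalIntegral.integral_sub (intervalIntegrable_F hκ _ _ _)
        (intervalIntegrable_F hκ _ _ _)]
    have hi := (intervalIntegrable_F hκ w s 1).sub (intervalIntegrable_F hκ v s 1)
    have e : ∀ c : ℝ, ∫ _ in s..1, c = (1 - s) * c := by simp
    constructor
    · refine le_of_mul_le_mul_left ?_ h1s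
      rw [← e]
      refine le_trans ?_ hdiff.ge
      exact intervalIntegral.integral_mono_on hs.2.le (by simp) hi
        fun t ht => (h t (hsub t ht) v hv w hw hvw).1
    · refine le_of_mul_le_mul_left ?_ h1s
      rw [← e (C * (w - v))]
      refine le_trans hdiff.le ?_
      exact intervalIntegral.integral_mono_on hs.2.le hi (by simp)
        fun t ht => (h t (hsub t ht) v hv w hw hvw).2

lemma continuousOn_F (hM : M.AssumptionE Z) (v : ℝ) : ContinuousOn (M.F v) (Icc 0 1) := by
  rcases le_total v M.vlo with hv | hv
  · exact continuousOn_const.congr fun s hs => (hM.isRegularLaw_valueLaw hs).cdf_of_le hv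
  rcases le_total M.vhi v with hv' | hv'
  · exact continuousOn_const.congr fun s hs => (hM.isRegularLaw_valueLaw hs).cdf_of_ge hv'
  obtain ⟨f, ε, C, hf, hε, hle, hC, hlaw⟩ := hM.exists_density
  have h0 : ∀ v s, 0 ≤ f v s := fun v s => hε.le.trans (hle v s)
  have hc : Continuous (fun s => ∫ x in M.vlo..v, f x s) :=
    intervalIntegral.continuous_parametric_intervalIntegral_of_continuous'
      (f := fun s x => f x s) (hf.comp continuous_swap) _ _
  exact hc.continuousOn.congr fun s hs => hM.F_eq_integral hf h0 hlaw hs ⟨hv, hv'⟩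

end AssumptionE

end EntryModel

/-! ### The outcome distribution. -/

/-- The probability that `m` of `N` buyers enter when each of them enters with probability
`1 - s`. -/
noncomputable def entryWeight (N : ℕ) (s : ℝ) (m : ℕ) : ℝ := N.choose m * (1 - s) ^ m * s ^ (N - m)

lemma entryWeight_pos {N m : ℕ} {s : ℝ} (hs : s ∈ Ioo (0 : ℝ) 1) (hm : m ≤ N) :
    0 < entryWeight N s m := by
  have h1 : 0 < 1 - s := sub_pos.2 hs.2
  have h2 : (0 : ℝ) < N.choose m := by exact_mod_cast Nat.choose_pos hm
  exact mul_pos (mul_pos h2 (pow_pos h1 _)) (pow_pos hs.1 _)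

lemma sum_entryWeight (N : ℕ) (s : ℝ) : ∑ m ∈ Finset.range (N + 1), entryWeight N s m = 1 := by
  have := add_pow (1 - s) s N
  rw [sub_add_cancel, one_pow] at this
  rw [this]
  exact Finset.sum_congr rfl fun m _ => by rw [entryWeight]; ring

namespace EntryModel

variable {E : Type*} {M : EntryModel E} {n : ℕ}

lemma jointLaw_real_Iio (hκ : IsMarkovKernel M.valueLaw) {s : ℝ} (hs : s ∈ Ioo (0 : ℝ) 1) :
    M.jointLaw.real (Iio s ×ˢ univ) = s := by
  have := isProbabilityMeasure_jointLaw hκ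
  have hc : (Iio s ×ˢ univ : Set (ℝ × ℝ)) = (Ici s ×ˢ univ)ᶜ := by
    ext p
    simp
  rw [hc, probReal_compl_eq_one_sub (measurableSet_Ici.prod MeasurableSet.univ),
    jointLaw_real_Ici hκ hs]
  ring

lemma mem_entrants {s : ℝ} {ω : Fin n → ℝ × ℝ} {i : Fin n} : i ∈ entrants s ω ↔ s ≤ (ω i).1 := by
  simp [entrants]

/-- The profiles of signals and values for which the set of entrants is `I` and they all bid at
most `b` according to `β`. -/
def entryBox (s : ℝ) (β : ℝ → ℝ) (b : ℝ) (I : Finset (Fin n)) : Set (Fin n → ℝ × ℝ) :=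
  univ.pi fun i => if i ∈ I then Ici s ×ˢ {w | β w ≤ b} else Iio s ×ˢ univ

lemma mem_entryBox {s b : ℝ} {β : ℝ → ℝ} {I : Finset (Fin n)} {ω : Fin n → ℝ × ℝ} :
    ω ∈ entryBox s β b I ↔ entrants s ω = I ∧ ∀ i ∈ I, β (ω i).2 ≤ b := by
  simp only [entryBox, mem_univ_pi, Finset.ext_iff, mem_entrants]
  constructor
  · intro h
    refine ⟨fun i => ?_, fun i hi => ?_⟩
    · have := h i
      by_cases hi : i ∈ I
      · rw [if_pos hi] at this
        exact iff_of_true this.1 hi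
      · rw [if_neg hi] at this
        exact iff_of_false (not_le.2 this.1) hi
    · have := h i
      rw [if_pos hi] at this
      exact this.2
  · rintro ⟨h1, h2⟩ i
    by_cases hi : i ∈ I
    · rw [if_pos hi]
      exact ⟨(h1 i).2 hi, h2 i hi⟩
    · rw [if_neg hi]
      exact ⟨not_le.1 fun h => hi ((h1 i).1 h), trivial⟩

lemma measurableSet_entryBox {s b : ℝ} {β : ℝ → ℝ} {I : Finset (Fin n)}
    (hβ : I.Nonempty → Measurable β) : MeasurableSet (entryBox s β b I) := by
  refine MeasurableSet.univ_pi fun i => ?_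
  split_ifs with hi
  · exact measurableSet_Ici.prod (measurableSet_le (hβ ⟨i, hi⟩) measurable_const)
  · exact measurableSet_Iio.prod MeasurableSet.univ

/-- The complement of "sold above `b`" includes "not sold", so an empty set of entrants needs no
separate treatment. -/
lemma outcome_notMem_iff {s b : ℝ} {β : ℕ → ℝ → ℝ} {ω : Fin n → ℝ × ℝ} :
    outcome s β ω ∉ Sum.inr '' Ioi b ↔
      ∀ i ∈ entrants s ω, β (entrants s ω).card (ω i).2 ≤ b := by
  unfold outcome
  split_ifs with h
  · simp
  · rw [Finset.not_nonempty_iff_eq_empty] at h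
    simp [h]

lemma measurableSet_entrants_eq (s : ℝ) (I : Finset (Fin n)) :
    MeasurableSet {ω : Fin n → ℝ × ℝ | entrants s ω = I} := by
  have : {ω : Fin n → ℝ × ℝ | entrants s ω = I} = entryBox s (fun _ => 0) 0 I := by
    ext ω
    simp [mem_entryBox]
  rw [this]
  exact measurableSet_entryBox fun _ => measurable_const

lemma measurable_outcome {s : ℝ} {β : ℕ → ℝ → ℝ}
    (hβ : ∀ m, 1 ≤ m → m ≤ n → Measurable (β m)) :
    Measurable (outcome s β : (Fin n → ℝ × ℝ) → Unit ⊕ ℝ) := by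
  -- `g I` is the outcome with the set of entrants frozen at `I`; the outcome is pieced together
  -- from these finitely many measurable maps.
  set g : Finset (Fin n) → (Fin n → ℝ × ℝ) → Unit ⊕ ℝ := fun I ω =>
    if h : I.Nonempty then Sum.inr (I.sup' h fun i => β I.card (ω i).2) else Sum.inl () with hg
  have hgm : ∀ I, Measurable (g I) := by
    intro I
    by_cases h : I.Nonempty
    · simp only [hg, dif_pos h]
      refine measurable_inr.comp ?_
      have hm := hβ I.card h.card_pos (by simpa using I.card_le_univ)
      have := Finset.measurable_sup' h (f := fun i (ω : Fin n → ℝ × ℝ) => β I.card (ω i).2)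
        fun i _ => hm.comp (measurable_snd.comp (measurable_pi_apply i))
      convert this using 1
      ext ω
      simp
    · simp only [hg, dif_neg h]
      exact measurable_const
  intro S hS
  have : outcome s β ⁻¹' S = ⋃ I, {ω : Fin n → ℝ × ℝ | entrants s ω = I} ∩ g I ⁻¹' S := by
    ext ω
    simp only [mem_preimage, mem_iUnion, mem_inter_iff, mem_ofPred_eq, exists_eq_left']
    rfl
  rw [this]
  exact MeasurableSet.iUnion fun I => (measurableSet_entrants_eq s I).inter (hgm I hS)

lemma pi_jointLaw_real_entryBox (hκ : IsMarkovKernel M.valueLaw) {s b : ℝ}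
    (hs : s ∈ Ioo (0 : ℝ) 1) {β : ℝ → ℝ} {I : Finset (Fin n)} (hβ : I.Nonempty → Measurable β) :
    (Measure.pi fun _ : Fin n => M.jointLaw).real (entryBox s β b I) =
      (1 - s) ^ I.card * s ^ (n - I.card) * (M.entrantLaw s).real {w | β w ≤ b} ^ I.card := by
  have := isProbabilityMeasure_jointLaw hκ
  rw [measureReal_def, entryBox, Measure.pi_pi, ENNReal.toReal_prod]
  have : ∀ i, (M.jointLaw (if i ∈ I then Ici s ×ˢ {w | β w ≤ b} else Iio s ×ˢ univ)).toReal =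
      if i ∈ I then (1 - s) * (M.entrantLaw s).real {w | β w ≤ b} else s := by
    intro i
    split_ifs with hi
    · rw [entrantLaw_real hκ hs (measurableSet_le (hβ ⟨i, hi⟩) measurable_const), measureReal_def]
    · rw [← measureReal_def, jointLaw_real_Iio hκ hs]
  simp only [this, Finset.prod_ite, Finset.prod_const]
  rw [show Finset.univ.filter (fun i => i ∉ I) = Iᶜ by ext; simp, Finset.card_compl,
    show Finset.univ.filter (fun i => i ∈ I) = I by ext; simp, Fintype.card_fin, mul_pow]
  ring

lemma pi_jointLaw_real_outcome_notMem (hκ : IsMarkovKernel M.valueLaw) {s : ℝ}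
    (hs : s ∈ Ioo (0 : ℝ) 1) {β : ℕ → ℝ → ℝ} (hβ : ∀ m, 1 ≤ m → m ≤ n → Measurable (β m))
    (b : ℝ) : (Measure.pi fun _ : Fin n => M.jointLaw).real
        (outcome s β ⁻¹' (Sum.inr '' Ioi b)ᶜ) =
      ∑ m ∈ Finset.range (n + 1),
        entryWeight n s m * (M.entrantLaw s).real {w | β m w ≤ b} ^ m := by
  have := isProbabilityMeasure_jointLaw hκ
  have hβ' : ∀ I : Finset (Fin n), I.Nonempty → Measurable (β I.card) := fun I h =>
    hβ I.card h.card_pos (by simpa using I.card_le_univ)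
  have hU : outcome s β ⁻¹' (Sum.inr '' Ioi b)ᶜ =
      ⋃ I ∈ (Finset.univ : Finset (Finset (Fin n))), entryBox s (β I.card) b I := by
    ext ω
    simp only [mem_preimage, mem_compl_iff, outcome_notMem_iff, mem_iUnion, mem_entryBox,
      Finset.mem_univ, exists_true_left]
    constructor
    · exact fun h => ⟨_, rfl, h⟩
    · rintro ⟨I, rfl, h⟩
      exact h
  rw [hU, measureReal_biUnion_finset]
  · simp only [pi_jointLaw_real_entryBox hκ hs (hβ' _)]
    -- The probability of a box depends only on the number of entrants; grouping by it produces the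
    -- binomial weights.
    rw [← Finset.powerset_univ, Finset.sum_powerset_apply_card (fun m =>
      (1 - s) ^ m * s ^ (n - m) * (M.entrantLaw s).real {w | β m w ≤ b} ^ m), Finset.card_univ,
      Fintype.card_fin]
    refine Finset.sum_congr rfl fun m _ => ?_
    rw [entryWeight, nsmul_eq_mul]
    ring
  · intro I _ J _ hIJ
    refine Set.disjoint_left.2 fun ω h1 h2 => hIJ ?_
    rw [mem_entryBox] at h1 h2
    rw [← h1.1, h2.1]
  · exact fun I _ => measurableSet_entryBox (hβ' I)

section Equilibrium

variable {Z : Set E} {σ : StrategyProfile E} {z : E}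

lemma IsInteriorEquilibrium.measurable_outcome (hσ : M.IsInteriorEquilibrium Z σ) (hz : z ∈ Z) :
    Measurable (outcome (σ.threshold z) (σ.bid z) : (Fin M.nbar → ℝ × ℝ) → Unit ⊕ ℝ) :=
  EntryModel.measurable_outcome fun m h1 h2 => (hσ.bidding z hz m h1 h2).measurable

lemma IsInteriorEquilibrium.isProbabilityMeasure_outcomeLaw (hκ : IsMarkovKernel M.valueLaw)
    (hσ : M.IsInteriorEquilibrium Z σ) (hz : z ∈ Z) :
    IsProbabilityMeasure (M.outcomeLaw σ z) := by
  have := isProbabilityMeasure_jointLaw hκ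
  exact Measure.isProbabilityMeasure_map (hσ.measurable_outcome hz).aemeasurable

lemma measurableSet_inr_Ioi (b : ℝ) : MeasurableSet (Sum.inr '' Ioi b : Set (Unit ⊕ ℝ)) :=
  measurableSet_Ioi.inr_image

variable [TopologicalSpace E]

/-- The probability that the auction is not sold at a price above `b`. -/
lemma outcomeLaw_real_compl_Ioi (hM : M.AssumptionE Z) (hσ : M.IsInteriorEquilibrium Z σ)
    (hz : z ∈ Z) (b : ℝ) : (M.outcomeLaw σ z).real (Sum.inr '' Ioi b)ᶜ =
      ∑ m ∈ Finset.range (M.nbar + 1), entryWeight M.nbar (σ.threshold z) m *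
        (M.entrantLaw (σ.threshold z)).real {w | σ.bid z m w ≤ b} ^ m := by
  rw [outcomeLaw, map_measureReal_apply (hσ.measurable_outcome hz)
    (measurableSet_inr_Ioi b).compl]
  exact pi_jointLaw_real_outcome_notMem hM.markov (hσ.threshold_mem z hz)
    (fun m h1 h2 => (hσ.bidding z hz m h1 h2).measurable) b

lemma outcomeLaw_real_unsold (hM : M.AssumptionE Z) (hσ : M.IsInteriorEquilibrium Z σ)
    (hz : z ∈ Z) : (M.outcomeLaw σ z).real {Sum.inl ()} = σ.threshold z ^ M.nbar := by
  have hm : MeasurableSet ({Sum.inl ()} : Set (Unit ⊕ ℝ)) := by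
    rw [← image_singleton]
    exact (measurableSet_singleton ()).inl_image
  rw [outcomeLaw, map_measureReal_apply (hσ.measurable_outcome hz) hm]
  have : outcome (σ.threshold z) (σ.bid z) ⁻¹' {Sum.inl ()} =
      entryBox (n := M.nbar) (σ.threshold z) (fun _ => 0) 0 ∅ := by
    ext ω
    simp only [mem_preimage, mem_singleton_iff, mem_entryBox, outcome]
    split_ifs with h
    · simp [h.ne_empty]
    · rw [Finset.not_nonempty_iff_eq_empty] at h
      simp [h]
  rw [this, pi_jointLaw_real_entryBox hM.markov (hσ.threshold_mem z hz) (by simp)]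
  simp

/-- The law of the number of entrants, minus two, given that there are at least two. -/
noncomputable def rivalryWeight (N : ℕ) (s : ℝ) (k : ℕ) : ℝ :=
  entryWeight N s (k + 2) / ∑ j ∈ Finset.range (N - 2 + 1), entryWeight N s (j + 2)

lemma sum_entryWeight_pos {N : ℕ} {s : ℝ} (hs : s ∈ Ioo (0 : ℝ) 1) (hN : 2 ≤ N) :
    0 < ∑ j ∈ Finset.range (N - 2 + 1), entryWeight N s (j + 2) :=
  Finset.sum_pos (fun j hj => entryWeight_pos hs (by simp at hj; omega)) ⟨0, by simp⟩

lemma rivalryWeight_pos {N k : ℕ} {s : ℝ} (hs : s ∈ Ioo (0 : ℝ) 1) (hN : 2 ≤ N) (hk : k ≤ N - 2) :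
    0 < rivalryWeight N s k :=
  div_pos (entryWeight_pos hs (by omega)) (sum_entryWeight_pos hs hN)

lemma sum_rivalryWeight {N : ℕ} {s : ℝ} (hs : s ∈ Ioo (0 : ℝ) 1) (hN : 2 ≤ N) :
    ∑ k ∈ Finset.range (N - 2 + 1), rivalryWeight N s k = 1 := by
  simp only [rivalryWeight]
  rw [← Finset.sum_div, div_self (sum_entryWeight_pos hs hN).ne']

lemma outcomeLaw_real_compl_Ioi_of_nonneg (hM : M.AssumptionE Z)
    (hσ : M.IsInteriorEquilibrium Z σ) (hz : z ∈ Z) {b : ℝ} (hb : 0 ≤ b) :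
    (M.outcomeLaw σ z).real (Sum.inr '' Ioi b)ᶜ =
      entryWeight M.nbar (σ.threshold z) 0 + entryWeight M.nbar (σ.threshold z) 1 +
      ∑ k ∈ Finset.range (M.nbar - 2 + 1), entryWeight M.nbar (σ.threshold z) (k + 2) *
        (hM.isRegularLaw_entrantLaw (hσ.threshold_mem z hz)).quantileIso.maxBidCDF k b := by
  have h2 := hM.two_le
  have hreg := hM.isRegularLaw_entrantLaw (hσ.threshold_mem z hz)
  have := hreg.isProbabilityMeasure
  rw [outcomeLaw_real_compl_Ioi hM hσ hz, show M.nbar + 1 = M.nbar - 2 + 1 + 1 + 1 by omega,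
    Finset.sum_range_succ', Finset.sum_range_succ']
  have hone : (M.entrantLaw (σ.threshold z)).real {w | σ.bid z 1 w ≤ b} = 1 := by
    rw [← probReal_univ (μ := M.entrantLaw (σ.threshold z))]
    refine measureReal_congr ?_
    filter_upwards [hreg.ae_mem_Ioc] with w hw
    refine propext (iff_of_true ?_ trivial)
    change σ.bid z 1 w ≤ b
    rwa [(hσ.bidding z hz 1 le_rfl (by omega)).bid_eq_zero (Ioc_subset_Icc_self hw)]
  simp only [zero_add, hone, pow_zero, mul_one, one_pow]
  rw [add_assoc, add_comm, add_comm (entryWeight M.nbar (σ.threshold z) 1)]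
  congr 1
  refine Finset.sum_congr rfl fun k hk => ?_
  rw [QuantileIso.maxBidCDF, ← (hσ.bidding z hz (k + 2) (by omega)
    (by simp at hk; omega)).measureReal_bid_le hreg]

theorem winningBidCDF_eq_mixtureCDF (hM : M.AssumptionE Z) (hσ : M.IsInteriorEquilibrium Z σ)
    (hz : z ∈ Z) (b : ℝ) : M.winningBidCDF σ z b =
      (hM.isRegularLaw_entrantLaw (hσ.threshold_mem z hz)).quantileIso.mixtureCDF (M.nbar - 2)
        (rivalryWeight M.nbar (σ.threshold z)) b := by
  have hreg := hM.isRegularLaw_entrantLaw (hσ.threshold_mem z hz)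
  have := hσ.isProbabilityMeasure_outcomeLaw hM.markov hz
  have hlo : hreg.quantileIso 0 = M.vlo := hreg.quantileIso_zero
  have hlo0 := hM.vlo_nonneg
  rw [winningBidCDF, measureReal_def, cond_apply (measurableSet_inr_Ioi 0), ENNReal.toReal_mul,
    ENNReal.toReal_inv, ← measureReal_def, ← measureReal_def]
  rcases lt_or_ge b 0 with hb | hb
  · have he : (Sum.inr '' Ioi 0 ∩ Sum.inr '' Iic b : Set (Unit ⊕ ℝ)) = ∅ := by
      ext x
      rcases x with x | x <;> simp
      intro hx
      linarith
    rw [he, measureReal_empty, mul_zero, eq_comm]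
    refine Finset.sum_eq_zero fun k _ => ?_
    rw [QuantileIso.maxBidCDF_eq_zero _ (by linarith), mul_zero]
  -- Writing `0 < W ≤ b` as a difference cancels the weights of zero and one entrant, which make up
  -- the whole mass of the complement of `W > 0`.
  have he : (Sum.inr '' Ioi 0 ∩ Sum.inr '' Iic b : Set (Unit ⊕ ℝ)) =
      (Sum.inr '' Ioi b)ᶜ \ (Sum.inr '' Ioi 0)ᶜ := by
    ext x
    rcases x with x | x <;> simp
    tauto
  have hzero := outcomeLaw_real_compl_Ioi_of_nonneg hM hσ hz le_rfl
  rw [Finset.sum_eq_zero (fun k _ => by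
    rw [QuantileIso.maxBidCDF_eq_zero _ (by linarith), mul_zero]), add_zero] at hzero
  have hsum := sum_entryWeight M.nbar (σ.threshold z)
  have h2 := hM.two_le
  rw [show M.nbar + 1 = M.nbar - 2 + 1 + 1 + 1 by omega,
    Finset.sum_range_succ', Finset.sum_range_succ'] at hsum
  simp only [zero_add] at hsum
  have hpos : (M.outcomeLaw σ z).real (Sum.inr '' Ioi 0) =
      ∑ j ∈ Finset.range (M.nbar - 2 + 1), entryWeight M.nbar (σ.threshold z) (j + 2) := by
    have := probReal_compl_eq_one_sub (μ := M.outcomeLaw σ z) (measurableSet_inr_Ioi 0)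
    linarith
  rw [he, measureReal_sdiff (compl_subset_compl.2 (image_mono (Ioi_subset_Ioi hb)))
    (measurableSet_inr_Ioi 0).compl, outcomeLaw_real_compl_Ioi_of_nonneg hM hσ hz hb, hzero,
    add_sub_cancel_left, hpos, QuantileIso.mixtureCDF, Finset.mul_sum]
  refine Finset.sum_congr rfl fun k _ => ?_
  rw [rivalryWeight]
  ring

end Equilibrium

end EntryModel

/-! ### First-order stochastic dominance. -/

namespace IsRegularLaw

variable {μ ν : Measure ℝ} {lo hi : ℝ}

lemma integrable_of_continuous (h : IsRegularLaw μ lo hi) {g : ℝ → ℝ} (hg : Continuous g) :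
    Integrable g μ := by
  have := h.isProbabilityMeasure
  obtain ⟨C, hC⟩ := isCompact_Icc.exists_bound_of_continuousOn (s := Icc lo hi) hg.continuousOn
  refine Integrable.of_bound hg.aestronglyMeasurable C ?_
  filter_upwards [h.ae_mem_Ioc] with v hv
  exact hC v (Ioc_subset_Icc_self hv)

lemma continuous_primitive {g : ℝ → ℝ} (hg : Continuous g) (a : ℝ) :
    Continuous (fun v => ∫ x in a..v, g x) :=
  intervalIntegral.continuous_primitive (fun _ _ => hg.intervalIntegrable _ _) a

/-- The layer-cake formula, applied to the nonnegative variable `v - lo`. Only tail probabilities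
appear, so they can be compared pointwise. -/
lemma ofReal_integral_primitive (h : IsRegularLaw μ lo hi) {g : ℝ → ℝ} (hg : Continuous g)
    (h0 : ∀ x, 0 ≤ g x) : ENNReal.ofReal (∫ v, (∫ x in lo..v, g x) ∂μ) =
      ∫⁻ t in Ioi 0, μ (Ioi (t + lo)) * ENNReal.ofReal (g (t + lo)) := by
  have hae : ∀ᵐ v ∂μ, lo ≤ v := by
    filter_upwards [h.ae_mem_Ioc] with v hv
    exact hv.1.le
  have hshift : ∀ v, ∫ x in lo..v, g x = ∫ t in (0 : ℝ)..(v - lo), g (t + lo) := fun v => by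
    rw [intervalIntegral.integral_comp_add_right]
    simp
  rw [ofReal_integral_eq_lintegral_ofReal
    (h.integrable_of_continuous (continuous_primitive hg lo))]
  · simp only [hshift]
    rw [lintegral_comp_eq_lintegral_meas_lt_mul μ (f := fun v => v - lo)
      (g := fun t => g (t + lo))]
    · refine lintegral_congr fun t => ?_
      congr 2
      ext v
      simp [lt_sub_iff_add_lt]
    · filter_upwards [hae] with v hv
      simpa using hv
    · fun_prop
    · exact fun t _ => Continuous.intervalIntegrable (by fun_prop) _ _
    · exact .of_forall fun t => h0 _
  · filter_upwards [hae] with v hv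
    exact intervalIntegral.integral_nonneg hv fun x _ => h0 x

/-- First-order stochastic dominance. -/
lemma integral_primitive_le (hμ : IsRegularLaw μ lo hi) (hν : IsRegularLaw ν lo hi)
    (hle : ∀ v ∈ Icc lo hi, cdf ν v ≤ cdf μ v) {g : ℝ → ℝ} (hg : Continuous g)
    (h0 : ∀ x, 0 ≤ g x) : ∫ v, (∫ x in lo..v, g x) ∂μ ≤ ∫ v, (∫ x in lo..v, g x) ∂ν := by
  have := hμ.isProbabilityMeasure
  have := hν.isProbabilityMeasure
  have hnn : 0 ≤ ∫ v, (∫ x in lo..v, g x) ∂ν := by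
    refine integral_nonneg_of_ae ?_
    filter_upwards [hν.ae_mem_Ioc] with v hv
    exact intervalIntegral.integral_nonneg hv.1.le fun x _ => h0 x
  rw [← ENNReal.ofReal_le_ofReal_iff hnn, hμ.ofReal_integral_primitive hg h0,
    hν.ofReal_integral_primitive hg h0]
  refine lintegral_mono fun t => mul_le_mul_left ?_ _
  have hall : cdf ν (t + lo) ≤ cdf μ (t + lo) := by
    rcases le_total (t + lo) lo with hv | hv
    · rw [hν.cdf_of_le hv]
      exact cdf_nonneg _ _
    rcases le_total hi (t + lo) with hv' | hv'
    · rw [hμ.cdf_of_ge hv']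
      exact cdf_le_one _ _
    exact hle _ ⟨hv, hv'⟩
  rw [← ENNReal.toReal_le_toReal (measure_ne_top _ _) (measure_ne_top _ _), ← measureReal_def,
    ← measureReal_def, ← compl_Iic, probReal_compl_eq_one_sub measurableSet_Iic,
    probReal_compl_eq_one_sub measurableSet_Iic, ← cdf_eq_real, ← cdf_eq_real]
  linarith

end IsRegularLaw

/-! ### The break-even condition and the set of thresholds. -/

namespace EntryModel

variable {E : Type*} {M : EntryModel E}

/-- The c.d.f. of the value of a potential rival, where a buyer who does not enter because her
signal is below `s` counts as one with the lowest value. -/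
noncomputable def rivalCDF (M : EntryModel E) (s x : ℝ) : ℝ := s + (1 - s) * M.Fc x s

/-- The expected equilibrium profit, gross of the entry cost, of an entrant of value `v` who does
not know yet how many of the other buyers enter. -/
noncomputable def grossProfit (M : EntryModel E) (s v : ℝ) : ℝ :=
  s ^ (M.nbar - 1) * M.vlo + ∫ x in M.vlo..v, M.rivalCDF s x ^ (M.nbar - 1)

/-- The expected equilibrium profit, gross of the entry cost, of a buyer whose signal is the common
entry threshold `s`. -/
noncomputable def thresholdProfit (M : EntryModel E) (s : ℝ) : ℝ :=
  ∫ v, M.grossProfit s v ∂(M.valueLaw s)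

lemma sum_entryWeight_mul_pow (N : ℕ) (s y : ℝ) :
    ∑ m ∈ Finset.range (N + 1), entryWeight N s m * y ^ m = (s + (1 - s) * y) ^ N := by
  rw [add_comm s, add_pow]
  refine Finset.sum_congr rfl fun m _ => ?_
  rw [entryWeight, mul_pow]
  ring

lemma rivalCDF_nonneg {s : ℝ} (hs : s ∈ Ioo (0 : ℝ) 1) (x : ℝ) : 0 ≤ M.rivalCDF s x :=
  add_nonneg hs.1.le (mul_nonneg (sub_nonneg.2 hs.2.le) (cdf_nonneg _ _))

/-- The function is `s + ∫ t in s..1, M.F x t`; raising the threshold to `t` replaces `M.F x ≤ 1` by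
`1` on `[s, t]`. -/
lemma rivalCDF_mono (hκ : IsMarkovKernel M.valueLaw) {s t : ℝ} (hs : s ∈ Ioo (0 : ℝ) 1)
    (ht : t ∈ Ioo (0 : ℝ) 1) (hst : s ≤ t) (x : ℝ) : M.rivalCDF s x ≤ M.rivalCDF t x := by
  rw [rivalCDF, rivalCDF, Fc_eq_integral hκ hs, Fc_eq_integral hκ ht,
    ← intervalIntegral.integral_add_adjacent_intervals (intervalIntegrable_F hκ x s t)
      (intervalIntegrable_F hκ x t 1)]
  have : ∫ y in s..t, M.F x y ≤ ∫ _ in s..t, (1 : ℝ) :=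
    intervalIntegral.integral_mono_on hst (intervalIntegrable_F hκ x s t) (by simp)
      fun y _ => cdf_le_one _ _
  simp only [intervalIntegral.integral_const, smul_eq_mul, mul_one] at this
  linarith

variable [TopologicalSpace E] {Z : Set E} {σ : StrategyProfile E} {z : E}

lemma AssumptionE.continuous_rivalCDF (hM : M.AssumptionE Z) {s : ℝ} (hs : s ∈ Ioo (0 : ℝ) 1) :
    Continuous (M.rivalCDF s) := by
  have h : Continuous (fun x => M.Fc x s) := (hM.isRegularLaw_entrantLaw hs).continuous
  unfold rivalCDF
  fun_prop

lemma AssumptionE.continuous_grossProfit (hM : M.AssumptionE Z) {s : ℝ} (hs : s ∈ Ioo (0 : ℝ) 1) :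
    Continuous (M.grossProfit s) := by
  refine continuous_const.add (IsRegularLaw.continuous_primitive ?_ _)
  exact (hM.continuous_rivalCDF hs).pow _

/-- A higher threshold weakens the competition, which strictly raises the profit at almost every
value, and it gives the marginal entrant a better signal, which helps weakly by stochastic
dominance. -/
lemma AssumptionE.strictMonoOn_thresholdProfit (hM : M.AssumptionE Z) :
    StrictMonoOn M.thresholdProfit (Ioo 0 1) := by
  intro s hs t ht hst
  have h2 := hM.two_le
  have hls := hM.isRegularLaw_valueLaw (Ioo_subset_Icc_self hs)
  have hlt := hM.isRegularLaw_valueLaw (Ioo_subset_Icc_self ht)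
  have := hls.isProbabilityMeasure
  have := hlt.isProbabilityMeasure
  have hcs := hM.continuous_rivalCDF hs
  have hct := hM.continuous_rivalCDF ht
  have hpoint : ∀ v ∈ Ioc M.vlo M.vhi, M.grossProfit s v < M.grossProfit t v := by
    intro v hv
    refine add_lt_add_of_le_of_lt (mul_le_mul_of_nonneg_right
      (pow_le_pow_left₀ hs.1.le hst.le _) hM.vlo_nonneg) ?_
    refine intervalIntegral.integral_lt_integral_of_continuousOn_of_le_of_exists_lt hv.1
      (by fun_prop) (by fun_prop) (fun x _ => pow_le_pow_left₀ (rivalCDF_nonneg hs x)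
        (rivalCDF_mono hM.markov hs ht hst.le x) _) ⟨M.vlo, ⟨le_rfl, hv.1.le⟩, ?_⟩
    -- At the lowest value `rivalCDF` is the threshold itself, so the integrands differ there;
    -- continuity makes the integrals differ.
    have e : ∀ r ∈ Ioo (0 : ℝ) 1, M.rivalCDF r M.vlo = r := fun r hr => by
      rw [rivalCDF, Fc, (hM.isRegularLaw_entrantLaw hr).cdf_lo]
      ring
    rw [e s hs, e t ht]
    exact pow_lt_pow_left₀ hst hs.1.le (by omega)
  have hstep : ∫ v, M.grossProfit s v ∂(M.valueLaw s) < ∫ v, M.grossProfit t v ∂(M.valueLaw s) := by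
    have his := hls.integrable_of_continuous (hM.continuous_grossProfit hs)
    have hit := hls.integrable_of_continuous (hM.continuous_grossProfit ht)
    rw [← sub_pos, ← integral_sub hit his,
      integral_pos_iff_support_of_nonneg_ae (f := fun v => M.grossProfit t v - M.grossProfit s v) _
        (hit.sub his)]
    · have : (M.valueLaw s)
          (Function.support fun v => M.grossProfit t v - M.grossProfit s v) = 1 := by
        rw [← measure_univ (μ := M.valueLaw s)]
        refine measure_congr ?_
        filter_upwards [hls.ae_mem_Ioc] with v hv
        exact propext (iff_of_true (sub_pos.2 (hpoint v hv)).ne' trivial)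
      rw [this]
      exact one_pos
    · filter_upwards [hls.ae_mem_Ioc] with v hv
      exact (sub_pos.2 (hpoint v hv)).le
  refine hstep.trans_le ?_
  have hc : Continuous (fun x => M.rivalCDF t x ^ (M.nbar - 1)) := hct.pow _
  have hp := IsRegularLaw.continuous_primitive hc M.vlo
  unfold thresholdProfit grossProfit
  rw [integral_add (integrable_const _) (hls.integrable_of_continuous hp),
    integral_add (integrable_const _) (hlt.integrable_of_continuous hp)]
  simp only [integral_const, probReal_univ, one_smul]
  refine add_le_add_right ?_ _
  exact hls.integral_primitive_le hlt (fun v hv => hM.antitone v hv (Ioo_subset_Icc_self hs)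
    (Ioo_subset_Icc_self ht) hst.le) hc fun x => pow_nonneg (rivalCDF_nonneg ht x) _

lemma IsInteriorEquilibrium.cost_eq_thresholdProfit (hM : M.AssumptionE Z)
    (hσ : M.IsInteriorEquilibrium Z σ) (hz : z ∈ Z) :
    M.cost z = M.thresholdProfit (σ.threshold z) := by
  have h2 := hM.two_le
  have hs := hσ.threshold_mem z hz
  rw [← hσ.breakEven z hz]
  set s := σ.threshold z with hsdef
  have hlaw := hM.isRegularLaw_valueLaw (Ioo_subset_Icc_self hs)
  have hreg := hM.isRegularLaw_entrantLaw hs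
  have hcFc : Continuous (fun x => M.Fc x s) := hreg.continuous
  -- `u m` is the profit against `m` rivals. A lone entrant pays nothing and earns `v = vlo + (v -
  -- vlo)`, hence the extra term at `m = 0`.
  set u : ℕ → ℝ → ℝ := fun m v =>
    (if m = 0 then M.vlo else 0) + ∫ x in M.vlo..v, M.Fc x s ^ m with hu
  have huc : ∀ m, Continuous (u m) := fun m =>
    continuous_const.add (IsRegularLaw.continuous_primitive (hcFc.pow m) _)
  have hprofit : ∀ m ∈ Finset.range M.nbar,
      ∫ v, (v - σ.bid z (m + 1) v) *
        winProb (M.entrantLaw s) (σ.bid z (m + 1)) m (σ.bid z (m + 1) v) ∂(M.valueLaw s) =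
      ∫ v, u m v ∂(M.valueLaw s) := by
    intro m hm
    have hm : m < M.nbar := by simpa using hm
    have heq := hσ.bidding z hz (m + 1) (by omega) (by omega)
    refine integral_congr_ae ?_
    filter_upwards [hlaw.ae_mem_Ioc] with v hv
    rcases Nat.eq_zero_or_pos m with rfl | hpos
    · rw [heq.bid_eq_zero (Ioc_subset_Icc_self hv)]
      simp [hu, winProb]
    · have := heq.profit_eq hreg (by omega) (Ioc_subset_Icc_self hv)
      rw [Nat.add_sub_cancel] at this
      rw [this, hu]
      simp only [hpos.ne', if_false, zero_add]
      rfl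
  have hsum : ∀ v, ∑ m ∈ Finset.range M.nbar, entryWeight (M.nbar - 1) s m * u m v =
      M.grossProfit s v := by
    intro v
    rw [show M.nbar = M.nbar - 1 + 1 by omega]
    simp only [hu, mul_add, Finset.sum_add_distrib, Nat.add_sub_cancel]
    rw [grossProfit]
    congr 1
    · rw [Finset.sum_eq_single 0 (fun m _ hm => by simp [hm]) (by simp)]
      simp [entryWeight]
    · simp only [← intervalIntegral.integral_const_mul]
      rw [← intervalIntegral.integral_finsetSum fun m _ =>
        Continuous.intervalIntegrable (by fun_prop) _ _]
      simp only [rivalCDF, sum_entryWeight_mul_pow]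
  rw [thresholdProfit, entryProfit]
  simp only [← hsum]
  rw [integral_finsetSum _ fun m _ => (hlaw.integrable_of_continuous (huc m)).const_mul _]
  refine Finset.sum_congr rfl fun m hm => ?_
  rw [hprofit m hm, integral_const_mul]
  rfl

/-- The intermediate value property is taken from the continuous cost and carried over by
injectivity of `thresholdProfit`; continuity of the threshold is not presupposed. -/
lemma IsInteriorEquilibrium.ordConnected_threshold (hM : M.AssumptionE Z)
    (hσ : M.IsInteriorEquilibrium Z σ) : (σ.threshold '' Z).OrdConnected := by
  refine ordConnected_of_Ioo ?_
  rintro _ ⟨z₁, hz₁, rfl⟩ _ ⟨z₂, hz₂, rfl⟩ - t ht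
  have h1 := hσ.threshold_mem z₁ hz₁
  have h2 := hσ.threshold_mem z₂ hz₂
  have htm : t ∈ Ioo (0 : ℝ) 1 := ⟨h1.1.trans ht.1, ht.2.trans h2.2⟩
  have hmono := hM.strictMonoOn_thresholdProfit
  have hoc := (hM.connected.isPreconnected.image _ hM.cost_continuous).ordConnected
  have hmem : M.thresholdProfit t ∈ Icc (M.cost z₁) (M.cost z₂) := by
    rw [hσ.cost_eq_thresholdProfit hM hz₁, hσ.cost_eq_thresholdProfit hM hz₂]
    exact ⟨(hmono h1 htm ht.1).le, (hmono htm h2 ht.2).le⟩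
  obtain ⟨z, hz, hcz⟩ := hoc.out (mem_image_of_mem _ hz₁) (mem_image_of_mem _ hz₂) hmem
  rw [hσ.cost_eq_thresholdProfit hM hz] at hcz
  exact ⟨z, hz, hmono.injOn (hσ.threshold_mem z hz) htm hcz⟩

/-- A non-constant cost makes the interval of thresholds nondegenerate, so derivatives within it are
unique even at its endpoints. -/
lemma IsInteriorEquilibrium.uniqueDiffOn_threshold (hM : M.AssumptionE Z)
    (hσ : M.IsInteriorEquilibrium Z σ) : UniqueDiffOn ℝ (σ.threshold '' Z) := by
  have hoc := hσ.ordConnected_threshold hM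
  refine uniqueDiffOn_convex hoc.convex ?_
  obtain ⟨z, hz, z', hz', hne⟩ := hM.cost_nonconstant
  have hne' : σ.threshold z ≠ σ.threshold z' := fun h => hne (by
    rw [hσ.cost_eq_thresholdProfit hM hz, hσ.cost_eq_thresholdProfit hM hz', h])
  have key : ∀ a ∈ σ.threshold '' Z, ∀ b ∈ σ.threshold '' Z, a < b →
      (interior (σ.threshold '' Z)).Nonempty := fun a ha b hb hab =>
    (nonempty_Ioo.2 hab).mono
      (interior_maximal (Ioo_subset_Icc_self.trans (hoc.out ha hb)) isOpen_Ioo)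
  rcases hne'.lt_or_gt with h | h
  · exact key _ (mem_image_of_mem _ hz) _ (mem_image_of_mem _ hz') h
  · exact key _ (mem_image_of_mem _ hz') _ (mem_image_of_mem _ hz) h

lemma AssumptionE.hasDerivAt_Fc (hM : M.AssumptionE Z) {s : ℝ} (hs : s ∈ Ioo (0 : ℝ) 1) (v : ℝ) :
    HasDerivAt (fun r => (1 - r) * M.Fc v r) (-M.F v s) s := by
  have hc : ContinuousOn (M.F v) (Ioo 0 1) := (hM.continuousOn_F v).mono Ioo_subset_Icc_self
  have h : HasDerivAt (fun r => ∫ t in r..1, M.F v t) (-M.F v s) s :=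
    intervalIntegral.integral_hasDerivAt_left (intervalIntegrable_F hM.markov v s 1)
      (hc.stronglyMeasurableAtFilter isOpen_Ioo s hs) (hc.continuousAt (isOpen_Ioo.mem_nhds hs))
  refine h.congr_of_eventuallyEq ?_
  filter_upwards [isOpen_Ioo.mem_nhds hs] with r hr
  exact Fc_eq_integral hM.markov hr v

/-! ### Identification of the primitives. -/

variable {M' : EntryModel E} {σ' : StrategyProfile E}

/-- The winning bid distribution identifies the number of buyers, the weights of the numbers of
entrants, and the distribution of the values of the entrants. -/
theorem identification_of_winningBidCDF (hM : M.AssumptionE Z) (hM' : M'.AssumptionE Z)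
    (hσ : M.IsInteriorEquilibrium Z σ) (hσ' : M'.IsInteriorEquilibrium Z σ') (hz : z ∈ Z)
    (h : ∀ b, M.winningBidCDF σ z b = M'.winningBidCDF σ' z b) :
    M.nbar = M'.nbar ∧ M.vlo = M'.vlo ∧
      (∀ k ≤ M.nbar - 2, rivalryWeight M.nbar (σ.threshold z) k =
        rivalryWeight M'.nbar (σ'.threshold z) k) ∧
      ∀ v, M.Fc v (σ.threshold z) = M'.Fc v (σ'.threshold z) := by
  have hs := hσ.threshold_mem z hz
  have hs' := hσ'.threshold_mem z hz
  have hreg := hM.isRegularLaw_entrantLaw hs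
  have hreg' := hM'.isRegularLaw_entrantLaw hs'
  have h2 := hM.two_le
  have h2' := hM'.two_le
  obtain ⟨hK, hw, hQ⟩ := QuantileIso.mixtureCDF_identification
    (fun k hk => rivalryWeight_pos hs h2 hk) (fun k hk => rivalryWeight_pos hs' h2' hk)
    (sum_rivalryWeight hs h2) (sum_rivalryWeight hs' h2')
    (Q := hreg.quantileIso) (Q' := hreg'.quantileIso) fun b => by
      rw [← winningBidCDF_eq_mixtureCDF hM hσ hz, ← winningBidCDF_eq_mixtureCDF hM' hσ' hz, h]
  refine ⟨by omega, ?_, hw, hreg.cdf_eq_of_quantileIso_eqOn hreg' hQ⟩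
  rw [← hreg.quantileIso_zero, ← hreg'.quantileIso_zero, hQ 0 (by simp)]

/-- The ratio of the weights of two and three entrants is free of the normalization and is a
constant times `s / (1 - s)`. Three entrants must be possible. -/
lemma threshold_eq_of_rivalryWeight_eq {N : ℕ} (hN : 3 ≤ N) {s s' : ℝ} (hs : s ∈ Ioo (0 : ℝ) 1)
    (hs' : s' ∈ Ioo (0 : ℝ) 1)
    (h : ∀ k ≤ N - 2, rivalryWeight N s k = rivalryWeight N s' k) : s = s' := by
  obtain ⟨j, rfl⟩ : ∃ j, N = j + 3 := ⟨N - 3, by omega⟩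
  have h0 := h 0 (by omega)
  have h1 := h 1 (by omega)
  have hr := sum_entryWeight_pos hs (N := j + 3) (by omega)
  have hr' := sum_entryWeight_pos hs' (N := j + 3) (by omega)
  have hmul := congrArg₂ (· * ·) h0 h1.symm
  simp only [rivalryWeight, zero_add, Nat.reduceAdd] at hmul
  have hcross : entryWeight (j + 3) s 2 * entryWeight (j + 3) s' 3 =
      entryWeight (j + 3) s' 2 * entryWeight (j + 3) s 3 := by
    rw [div_mul_div_comm, div_mul_div_comm, mul_comm (∑ j_1 ∈ _, entryWeight (j + 3) s' (j_1 + 2)),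
      div_left_inj' (mul_pos hr hr').ne'] at hmul
    exact hmul
  simp only [entryWeight, show j + 3 - 2 = j + 1 by omega, show j + 3 - 3 = j by omega] at hcross
  have hc2 : (0 : ℝ) < (j + 3).choose 2 := by exact_mod_cast Nat.choose_pos (by omega)
  have hc3 : (0 : ℝ) < (j + 3).choose 3 := by exact_mod_cast Nat.choose_pos (by omega)
  have hq : 0 < 1 - s := sub_pos.2 hs.2
  have hq' : 0 < 1 - s' := sub_pos.2 hs'.2
  have hsj := pow_pos hs.1 j
  have hsj' := pow_pos hs'.1 j
  -- `X` collects the factors common to both sides of `hcross`.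
  set X : ℝ := (j + 3).choose 2 * (j + 3).choose 3 * (1 - s) ^ 2 * (1 - s') ^ 2 * s ^ j * s' ^ j
    with hX
  have hXpos : 0 < X := by positivity
  have : X * (s * (1 - s')) = X * (s' * (1 - s)) := by
    rw [hX]
    linear_combination hcross
  have := mul_left_cancel₀ hXpos.ne' this
  linarith

/-- When the thresholds and the distributions of the values of the entrants agree, so do the costs
and the distributions of the values given the threshold signals. -/
theorem identification_of_threshold_eq (hM : M.AssumptionE Z) (hM' : M'.AssumptionE Z)
    (hσ : M.IsInteriorEquilibrium Z σ) (hσ' : M'.IsInteriorEquilibrium Z σ')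
    (hnbar : M.nbar = M'.nbar) (hvlo : M.vlo = M'.vlo)
    (hth : ∀ z ∈ Z, σ.threshold z = σ'.threshold z)
    (hFc : ∀ z ∈ Z, ∀ v, M.Fc v (σ.threshold z) = M'.Fc v (σ'.threshold z)) :
    (∀ z ∈ Z, M.cost z = M'.cost z) ∧ ∀ s ∈ σ.threshold '' Z, ∀ v, M.F v s = M'.F v s := by
  have hFc' : ∀ s ∈ σ.threshold '' Z, ∀ v, M.Fc v s = M'.Fc v s := by
    rintro _ ⟨z, hz, rfl⟩ v
    rw [hFc z hz v, hth z hz]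
  have hsub : ∀ s ∈ σ.threshold '' Z, s ∈ Ioo (0 : ℝ) 1 := by
    rintro _ ⟨z, hz, rfl⟩
    exact hσ.threshold_mem z hz
  have hF : ∀ s ∈ σ.threshold '' Z, ∀ v, M.F v s = M'.F v s := by
    intro s hs v
    have d := (hM.hasDerivAt_Fc (hsub s hs) v).hasDerivWithinAt (s := σ.threshold '' Z)
    have d' := ((hM'.hasDerivAt_Fc (hsub s hs) v).hasDerivWithinAt (s := σ.threshold '' Z)).congr
      (f₁ := fun r => (1 - r) * M.Fc v r) (fun r hr => by rw [hFc' r hr v])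
      (by rw [hFc' s hs v])
    exact neg_injective ((hσ.uniqueDiffOn_threshold hM s hs).eq_deriv _ d d')
  refine ⟨fun z hz => ?_, hF⟩
  have hz' := mem_image_of_mem σ.threshold hz
  rw [hσ.cost_eq_thresholdProfit hM hz, hσ'.cost_eq_thresholdProfit hM' hz, ← hth z hz]
  have := hM.markov
  have := hM'.markov
  have hlaw : M.valueLaw (σ.threshold z) = M'.valueLaw (σ.threshold z) :=
    Measure.eq_of_cdf _ _ (StieltjesFunction.ext fun v => hF _ hz' v)
  have hgross : M.grossProfit (σ.threshold z) = M'.grossProfit (σ.threshold z) := by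
    ext v
    simp only [grossProfit, rivalCDF, hFc' _ hz', hnbar, hvlo]
  rw [thresholdProfit, thresholdProfit, hlaw, hgross]

end EntryModel

theorem mainTheorem10 {d : ℕ} (Z : Set (EuclideanSpace ℝ (Fin d)))
    (M M' : EntryModel (EuclideanSpace ℝ (Fin d)))
    (σ σ' : StrategyProfile (EuclideanSpace ℝ (Fin d)))
    (hM : M.AssumptionE Z) (hM' : M'.AssumptionE Z)
    (hσ : M.IsInteriorEquilibrium Z σ) (hσ' : M'.IsInteriorEquilibrium Z σ') :
    (∀ z ∈ Z, (∀ b, M.winningBidCDF σ z b = M'.winningBidCDF σ' z b) →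
      M.nbar = M'.nbar ∧ ∀ v, M.Fc v (σ.threshold z) = M'.Fc v (σ'.threshold z)) ∧
    (3 ≤ M.nbar →
      (∀ z ∈ Z, ∀ b, M.winningBidCDF σ z b = M'.winningBidCDF σ' z b) →
      (∀ z ∈ Z, σ.threshold z = σ'.threshold z) ∧
      (∀ z ∈ Z, M.cost z = M'.cost z) ∧
      ∀ s ∈ σ.threshold '' Z, ∀ v, M.F v s = M'.F v s) ∧
    (M.nbar = 2 →
      (∀ z ∈ Z, M.outcomeLaw σ z = M'.outcomeLaw σ' z) →
      (∀ z ∈ Z, σ.threshold z = σ'.threshold z) ∧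
      (∀ z ∈ Z, M.cost z = M'.cost z) ∧
      ∀ s ∈ σ.threshold '' Z, ∀ v, M.F v s = M'.F v s) := by
  have hid := fun z (hz : z ∈ Z) =>
    EntryModel.identification_of_winningBidCDF hM hM' hσ hσ' hz
  obtain ⟨z₀, hz₀⟩ := hM.connected.nonempty
  refine ⟨fun z hz h => ?_, fun h3 h => ?_, fun hn h => ?_⟩
  · obtain ⟨h1, -, -, h2⟩ := hid z hz h
    exact ⟨h1, h2⟩
  · have hth : ∀ z ∈ Z, σ.threshold z = σ'.threshold z := fun z hz => by
      obtain ⟨h1, -, hw, -⟩ := hid z hz (h z hz)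
      rw [← h1] at hw
      exact EntryModel.threshold_eq_of_rivalryWeight_eq h3 (hσ.threshold_mem z hz)
        (hσ'.threshold_mem z hz) hw
    obtain ⟨hn, hlo, -, -⟩ := hid z₀ hz₀ (h z₀ hz₀)
    exact ⟨hth, EntryModel.identification_of_threshold_eq hM hM' hσ hσ' hn hlo hth
      fun z hz => (hid z hz (h z hz)).2.2.2⟩
  · have hG : ∀ z ∈ Z, ∀ b, M.winningBidCDF σ z b = M'.winningBidCDF σ' z b := fun z hz b => by
      rw [EntryModel.winningBidCDF, EntryModel.winningBidCDF, h z hz]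
    obtain ⟨hn', hlo, -, -⟩ := hid z₀ hz₀ (hG z₀ hz₀)
    -- With two buyers there is a single rivalry weight, equal to one, which carries no information;
    -- the no-sale probability is the square of the threshold.
    have hth : ∀ z ∈ Z, σ.threshold z = σ'.threshold z := fun z hz => by
      have h1 := EntryModel.outcomeLaw_real_unsold hM hσ hz
      have h2 := EntryModel.outcomeLaw_real_unsold hM' hσ' hz
      rw [h z hz, h2, ← hn', hn] at h1
      exact ((pow_left_inj₀ (hσ'.threshold_mem z hz).1.le (hσ.threshold_mem z hz).1.le
        two_ne_zero).1 h1).symm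
    exact ⟨hth, EntryModel.identification_of_threshold_eq hM hM' hσ hσ' hn' hlo hth
      fun z hz => (hid z hz (hG z hz)).2.2.2⟩
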